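/- Setting. There are $K\ge 2$ arms and rounds $n=1,2,\ldots$. The rewards $X_k(n)$ are random variables with values in $[0,1]$, independent over all arms $k$ and rounds $n$, with means $\mu_k(n)=\mathbb E[X_k(n)]$; $\mu^\star(n)=\max_k\mu_k(n)$. Let $G=(V,E)$ be an undirected graph on the set of arms such that, in every round $n$, from each arm there is a path in $G$ to an optimal arm along which $\mu_\cdot(n)$ strictly increases (this holds if $\mu(n)$ is unimodal with respect to $G$, and it always holds for the complete graph). For $\Delta>0$ let $$H(\Delta,T)=\sum_{n=1}^T\sum_{(k,k')\in E}\mathbf 1\{|\mu_k(n)-\mu_{k'}(n)|<\Delta\},$$ each edge being counted once. The regret of a policy that selects the arms $k(n)$ is $R(T)=\sum_{n=1}^T(\mu^\star(n)-\mathbb E[\mu_{k(n)}(n)])$. Algorithm. Let $c>0$ and let $I(p,q)=p\log\frac pq+(1-p)\log\frac{1-p}{1-q}$. Put $F(p,s,m)=\sup\{q\in[p,1]: s\,I(p,q)\le\log m+c\log\log m\}$, with $F(p,0,m)=F(1,s,m)=1$. SW-KL-UCB with window $\tau$ selects in round $n$, on the basis of the arms selected and the rewards observed in rounds $1,\dots,n-1$,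 an arm $k$ that maximizes $F(\hat\mu_k(n),t_k(n),\tau)$ (ties are broken arbitrarily), where $t_k(n)$ is the number of selections of arm $k$ among the rounds $t\geq 1$ with $n-\tau\le t\le n-1$, and $\hat\mu_k(n)$ is the average of the rewards observed in these selections ($0$ if there are none). Theorem. For every $c>0$ there is a constant $C_1>0$, depending only on $c$, such that the following holds. Let $\tau\ge2$ be an integer. Assume that $|\mu_k(n)-\mu_k(n')|\le\sigma|n-n'|$ for all $k$ and all $n,n'\ge1$, that $\mu^\star(n)\in[a,1-a]$ for all $n\ge1$ with some $a>0$, that $a>\sigma\tau$, and that $\Delta>2\tau\sigma$. Put $g_0=(a-\sigma\tau)(1-a+\sigma\tau)/2$. Then for all $T\ge1$ the regret of SW-KL-UCB with window $\tau$ satisfies $$\frac{R(T)}{T}\le\frac{H(\Delta,T)}{T}\,\Delta+K\bigl(1+g_0^{-1/2}\bigr)\frac{\log\tau+c\log\log\tau+C_1}{2\min(\tau,T)\,(\Delta-2\tau\sigma)^2}.$$ In particular, for $T\ge\tau$ the last denominator is $2\tau(\Delta-2\tau\sigma)^2$. -/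

import Mathlib

open MeasureTheory ProbabilityTheory

noncomputable section

namespace SlidingBandit

/-- Kullback-Leibler divergence `I(p,q)` between Bernoulli distributions of means `p` and `q`
(only used for `0 ≤ p ≤ q < 1`, where it is finite and given by this formula). -/
def klBer (p q : ℝ) : ℝ :=
  p * Real.log (p / q) + (1 - p) * Real.log ((1 - p) / (1 - q))

/-- `F(p,s,n) = sup {q ≥ p : s I(p,q) ≤ log n + c log log n}`, with the conventions
`F(p,0,n) = 1` and `F(1,s,n) = 1`. For `p < 1` and `s ≥ 1` the value `q = 1` is left out, since
there `I(p,1) = ∞`. -/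
def klIndex (c p : ℝ) (s n : ℕ) : ℝ :=
  if s = 0 ∨ p = 1 then 1
  else sSup {q : ℝ | p ≤ q ∧ q < 1 ∧
    (s : ℝ) * klBer p q ≤ Real.log n + c * Real.log (Real.log n)}

section Model

variable {K : ℕ} {Ω : Type*}

/-- The rounds among the `τ` rounds `n - τ, …, n - 1` preceding round `n` (rounds start at `1`)
in which arm `i` was selected. -/
def windowPulls (τ : ℕ) (k : ℕ → Ω → Fin K) (i : Fin K) (n : ℕ) (ω : Ω) : Finset ℕ :=
  {t ∈ Finset.Ico 1 n | n ≤ t + τ ∧ k t ω = i}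

/-- Empirical mean reward of arm `i` over the window preceding round `n`; it is `0` if the arm was
not selected in the window. -/
def windowMean (τ : ℕ) (X : Fin K → ℕ → Ω → ℝ) (k : ℕ → Ω → Fin K) (i : Fin K) (n : ℕ)
    (ω : Ω) : ℝ :=
  (∑ t ∈ windowPulls τ k i n ω, X i t ω) / ((windowPulls τ k i n ω).card : ℝ)

/-- The sliding-window KL-UCB index of arm `i` at round `n`. -/
def swIndex (c : ℝ) (τ : ℕ) (X : Fin K → ℕ → Ω → ℝ) (k : ℕ → Ω → Fin K) (i : Fin K) (n : ℕ)
    (ω : Ω) : ℝ :=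
  klIndex c (windowMean τ X k i n ω) (windowPulls τ k i n ω).card τ

/-- The σ-algebra generated by the selected arms and the observed rewards of rounds `1, …, n`. -/
def history (X : Fin K → ℕ → Ω → ℝ) (k : ℕ → Ω → Fin K) (n : ℕ) : MeasurableSpace Ω :=
  ⨆ t ∈ Finset.Icc 1 n,
    MeasurableSpace.comap (fun ω => (k t ω, X (k t ω) t ω)) inferInstance

/-- The sequence `k` of selected arms is produced by SW-KL-UCB with window `τ`: the arm selected
in round `n` is determined by the observations of the earlier rounds, and it maximizes the index
(ties are broken in an arbitrary way). -/
structure IsSWKLUCB (c : ℝ) (τ : ℕ) (X : Fin K → ℕ → Ω → ℝ) (k : ℕ → Ω → Fin K) : Prop where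
  adapted : ∀ n, 1 ≤ n → Measurable[history X k (n - 1)] (k n)
  maximizes : ∀ n, 1 ≤ n → ∀ ω i, swIndex c τ X k i n ω ≤ swIndex c τ X k (k n ω) n ω

variable [MeasurableSpace Ω]

/-- `X i n` is the reward of arm `i` at round `n ≥ 1`: rewards lie in `[0,1]` and are independent
across rounds and arms. -/
structure IsRewardProcess (P : Measure Ω) (X : Fin K → ℕ → Ω → ℝ) : Prop where
  measurable : ∀ i n, 1 ≤ n → Measurable (X i n)
  mem_Icc : ∀ i n, 1 ≤ n → ∀ᵐ ω ∂P, X i n ω ∈ Set.Icc (0 : ℝ) 1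
  indep : iIndepFun (fun p : Fin K × ℕ => X p.1 (p.2 + 1)) P

/-- Expected reward `μ_i(n)` of arm `i` at round `n`. -/
def meanReward (P : Measure Ω) (X : Fin K → ℕ → Ω → ℝ) (i : Fin K) (n : ℕ) : ℝ :=
  ∫ ω, X i n ω ∂P

/-- Best expected reward `μ⋆(n)` at round `n`. -/
def bestMean (P : Measure Ω) (X : Fin K → ℕ → Ω → ℝ) (n : ℕ) : ℝ :=
  ⨆ i, meanReward P X i n

/-- Regret `R(T) = ∑_{n=1}^T (μ⋆(n) - E[μ_{k(n)}(n)])`. -/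
def regret (P : Measure Ω) (X : Fin K → ℕ → Ω → ℝ) (k : ℕ → Ω → Fin K) (T : ℕ) : ℝ :=
  ∑ n ∈ Finset.Icc 1 T, (bestMean P X n - ∫ ω, meanReward P X (k n ω) n ∂P)

end Model

section Graph

variable {K : ℕ}

open Classical in
/-- `H(Δ,T) = ∑_{n=1}^T ∑_{(k,k') ∈ E} 1{|μ_k(n) - μ_{k'}(n)| < Δ}`, where every edge of the
undirected graph is counted once. -/
def closeCount (G : SimpleGraph (Fin K)) (μ : Fin K → ℕ → ℝ) (Δ : ℝ) (T : ℕ) : ℕ :=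
  ∑ n ∈ Finset.Icc 1 T,
    Finset.card {e : Fin K × Fin K | e.1 < e.2 ∧ G.Adj e.1 e.2 ∧ |μ e.1 n - μ e.2 n| < Δ}

/-- There is a path of `G` from `i` to `j` along which `v` strictly increases. -/
def IncreasingPath (G : SimpleGraph (Fin K)) (v : Fin K → ℝ) (i j : Fin K) : Prop :=
  Relation.ReflTransGen (fun x y => G.Adj x y ∧ v x < v y) i j

/-- The set `U_G` of unimodal vectors: there is a unique best arm, and every arm is
joined to it by an increasing path. -/
def Unimodal (G : SimpleGraph (Fin K)) (v : Fin K → ℝ) : Prop :=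
  ∃ j, (∀ i, i ≠ j → v i < v j) ∧ ∀ i, IncreasingPath G v i j

/-- Unimodality in which several arms may be optimal: every arm is joined to some best arm by an
increasing path. -/
def UnimodalTies (G : SimpleGraph (Fin K)) (v : Fin K → ℝ) : Prop :=
  ∀ i, ∃ j, (∀ l, v l ≤ v j) ∧ IncreasingPath G v i j

theorem Unimodal.unimodalTies {G : SimpleGraph (Fin K)} {v : Fin K → ℝ} (h : Unimodal G v) :
    UnimodalTies G v := by
  obtain ⟨j, hj, hp⟩ := h
  refine fun i => ⟨j, fun l => ?_, hp i⟩
  by_cases hl : l = j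
  · rw [hl]
  · exact (hj l hl).le

/-- On the complete graph (bandits without structure) the condition holds for all vectors. -/
theorem unimodalTies_top (v : Fin K → ℝ) : UnimodalTies (⊤ : SimpleGraph (Fin K)) v := by
  intro i
  haveI : Nonempty (Fin K) := ⟨i⟩
  obtain ⟨j, hj⟩ := Finite.exists_max v
  by_cases hij : v i < v j
  · refine ⟨j, hj, Relation.ReflTransGen.single ⟨?_, hij⟩⟩
    rw [SimpleGraph.top_adj]
    rintro rfl
    exact lt_irrefl _ hij
  · exact ⟨i, fun l => (hj l).trans (not_lt.mp hij), Relation.ReflTransGen.refl⟩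

end Graph

end SlidingBandit

end

noncomputable section

namespace SlidingBandit

/-! Put `D = Δ - 2τσ` and `δ = log τ + c log log τ`. If the selected arm has gap less than `Δ` and
is not optimal, the first edge of its increasing path joins it to an arm closer than `Δ`; such
rounds are paid for by `H(Δ,T) Δ` (`UnimodalTies.gap_le`). It remains to count rounds of gap at
least `Δ`, each costing at most `1`.

Means drift by at most `στ` within a window. Fix the level `q = μ⋆(n) - στ - D/48`: window means of
a currently optimal arm are at least `q + D/48`, those of an arm of gap `≥ Δ` at most `q - 47D/48`.
In a round of large gap either the optimal arm has index below `q`, or the selected arm has index at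
least `q`.

Optimal arm (`exists_bound_swIndex_lt`): for each possible number `s` of selections in the window,
one exponential tilt bounds the deviation by `exp(-δ - 2s(D/48)²)`. The slack `D/48` makes the sum
over `s` converge, so the probability is of order `1/(τD²)`.

Selected arm (`exists_bound_block`): cut time into blocks of `τ` rounds and number the selections of
an arm inside a block by `a`, the count of earlier ones. By Pinsker, once `a` exceeds about
`15δ/(16D²)` a high index forces large noise in the window, either before the block or inside it.
Hoeffding supermartingales make both kinds of selections summable in `a`. There are at most `2T /
min(τ,T)` blocks.

Both estimates rest on `IsRewardProcess.selProd_le_one`, the supermartingale property for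
predictable selections. The factor `15/8` of `δ/D²` per `T/min(τ,T)` and per arm fits because `g₀ ≤
1/8` gives `1 + g₀^{-1/2} ≥ 15/4`. -/

/-! ### Bernoulli divergence, exponential tilts and the index -/

theorem klBer_self {p : ℝ} (h1 : p < 1) : klBer p p = 0 := by
  unfold klBer
  have h : (1 - p) / (1 - p) = 1 := div_self (by linarith)
  rw [h]
  rcases eq_or_ne p 0 with rfl | h0
  · simp
  · simp [div_self h0]

/-- The divergence grows at least quadratically in its second argument. -/
theorem klBer_add_sq_le {p q m : ℝ} (hp : 0 ≤ p) (hpq : p ≤ q) (hqm : q ≤ m) (hm : m < 1) :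
    klBer p q + 2 * (m - q) ^ 2 ≤ klBer p m := by
  -- Up to a constant this is `I(p,y) - 2(y-p)²`, with derivative `(y-p)(1-2y)²/(y(1-y))`.
  -- Monotonicity suffices since `(m-p)² - (q-p)² ≥ (m-q)²`.
  have hmono : MonotoneOn
      (fun y => -(p * Real.log y) - (1 - p) * Real.log (1 - y) - 2 * (y - p) ^ 2)
      (Set.Ico p 1) := by
    apply monotoneOn_of_hasDerivWithinAt_nonneg (convex_Ico p 1)
      (f' := fun y => -(p * y⁻¹) - (1 - p) * (-(1 - y)⁻¹) - 4 * (y - p))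
    · apply ContinuousOn.sub (ContinuousOn.sub (ContinuousOn.neg _) _) (by fun_prop)
      · rcases hp.eq_or_lt with rfl | hp0
        · simpa using continuousOn_const
        · refine continuousOn_const.mul (Real.continuousOn_log.mono ?_)
          intro y hy
          exact (hp0.trans_le hy.1).ne'
      · refine continuousOn_const.mul (ContinuousOn.log (by fun_prop) ?_)
        intro y hy
        linarith [hy.2]
    · intro y hy
      rw [interior_Ico] at hy
      have hy0 : y ≠ 0 := (hp.trans_lt hy.1).ne'
      have hy1 : 1 - y ≠ 0 := by linarith [hy.2]
      have h1 := ((Real.hasDerivAt_log hy0).const_mul p).neg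
      have h2 := (((hasDerivAt_id y).const_sub 1).log hy1).const_mul (1 - p)
      have h3 := (((hasDerivAt_id y).sub_const p).pow 2).const_mul 2
      refine (((h1.sub h2).sub h3).congr_deriv ?_).hasDerivWithinAt
      simp only [id, Nat.cast_ofNat]
      ring
    · intro y hy
      rw [interior_Ico] at hy
      have hy0 : 0 < y := hp.trans_lt hy.1
      have hy1 : 0 < 1 - y := by linarith [hy.2]
      have e : -(p * y⁻¹) - (1 - p) * (-(1 - y)⁻¹) - 4 * (y - p)
          = (y - p) * (1 - 2 * y) ^ 2 / (y * (1 - y)) := by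
        field_simp
        ring
      rw [e]
      have : 0 ≤ y - p := by linarith [hy.1]
      positivity
  have key := hmono ⟨hpq, hqm.trans_lt hm⟩ ⟨hpq.trans hqm, hm⟩ hqm
  have expand : ∀ y, p ≤ y → y < 1 → klBer p y
      = p * Real.log p - p * Real.log y
        + ((1 - p) * Real.log (1 - p) - (1 - p) * Real.log (1 - y)) := by
    intro y hy hy1
    unfold klBer
    have hlt : 1 - p ≠ 0 := by linarith
    have hlt' : 1 - y ≠ 0 := by linarith
    rw [Real.log_div hlt hlt']
    rcases hp.eq_or_lt with rfl | hp0
    · simp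
    · rw [Real.log_div hp0.ne' (hp0.trans_le hy).ne']
      ring
  rw [expand q hpq (hqm.trans_lt hm), expand m (hpq.trans hqm) hm]
  simp only at key
  nlinarith [mul_nonneg (sub_nonneg.2 hpq) (sub_nonneg.2 hqm)]

theorem two_mul_sq_le_klBer {p q : ℝ} (hp : 0 ≤ p) (hpq : p ≤ q) (hq : q < 1) :
    2 * (q - p) ^ 2 ≤ klBer p q := by
  have := klBer_add_sq_le hp le_rfl hpq hq
  rwa [klBer_self (hpq.trans_lt hq), zero_add] at this

/-- Variational form of the divergence, at the optimal tilt. -/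
theorem klBer_eq_tilt {x m : ℝ} (hx : 0 < x) (hx1 : x < 1) (hm : 0 < m) (hm1 : m < 1) :
    Real.log (x * (1 - m) / (m * (1 - x))) * x
      - Real.log (1 - m + m * Real.exp (Real.log (x * (1 - m) / (m * (1 - x))))) = klBer x m := by
  have h1 : 0 < 1 - m := by linarith
  have h2 : 0 < 1 - x := by linarith
  rw [Real.exp_log (by positivity)]
  have e : 1 - m + m * (x * (1 - m) / (m * (1 - x))) = (1 - m) / (1 - x) := by
    field_simp
    ring
  rw [e]
  unfold klBer
  rw [Real.log_div (by positivity) (by positivity), Real.log_mul (by positivity) (by positivity),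
    Real.log_mul (by positivity) (by positivity), Real.log_div (by positivity) (by positivity),
    Real.log_div (by positivity) (by positivity), Real.log_div (by positivity) (by positivity)]
  ring

theorem tilt_nonpos {x m : ℝ} (hx : 0 < x) (hxm : x ≤ m) (hm1 : m < 1) :
    Real.log (x * (1 - m) / (m * (1 - x))) ≤ 0 := by
  have h1 : 0 < 1 - m := by linarith
  have h2 : 0 < 1 - x := by linarith
  have h3 : 0 < m := by linarith
  apply Real.log_nonpos (by positivity)
  rw [div_le_one (by positivity)]
  nlinarith

/-- For `x > 0` this is the three-point identity `I(x,q) = I(x,p) + I(p,q) + (x-p)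
log(p(1-q)/(q(1-p)))`, whose last term is nonnegative because both of its factors are at most zero.
-/
theorem klBer_anti_left {x p q : ℝ} (hx : 0 ≤ x) (hxp : x ≤ p) (hpq : p ≤ q) (hq : q < 1) :
    klBer p q ≤ klBer x q := by
  rcases hx.eq_or_lt with rfl | hx0
  · rcases hxp.eq_or_lt with rfl | hp0
    · exact le_rfl
    · have h1 : 0 < 1 - q := by linarith
      have h2 : 0 < 1 - p := by linarith
      have h4 : 0 < q := by linarith
      unfold klBer
      have e1 : Real.log (p / q) ≤ 0 := Real.log_nonpos (by positivity) (by
        rw [div_le_one h4]; exact hpq)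
      have e2 : Real.log ((1 - p) / (1 - q)) ≤ Real.log ((1 - 0) / (1 - q)) := by
        apply Real.log_le_log (by positivity)
        gcongr
      have e3 : 0 ≤ Real.log ((1 - p) / (1 - q)) := Real.log_nonneg (by
        rw [le_div_iff₀ h1]; linarith)
      nlinarith
  · have hp0 : 0 < p := by linarith
    have h0 := two_mul_sq_le_klBer hx hxp (hpq.trans_lt hq)
    have h1 : 0 < 1 - q := by linarith
    have h2 : 0 < 1 - p := by linarith
    have h3 : 0 < 1 - x := by linarith
    have h4 : 0 < q := by linarith
    have ht := tilt_nonpos hp0 hpq hq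
    rw [Real.log_div (by positivity) (by positivity), Real.log_mul (by positivity) (by positivity),
      Real.log_mul (by positivity) (by positivity)] at ht
    unfold klBer at h0 ⊢
    rw [Real.log_div (by positivity) (by positivity), Real.log_div (by positivity) (by positivity)]
      at h0 ⊢
    rw [Real.log_div (by positivity) (by positivity), Real.log_div (by positivity) (by positivity)]
    nlinarith [sq_nonneg (p - x)]

/-- Rewriting through `y log y` yields continuity also at `p = 0` and `p = 1`; the intermediate
value argument for the tilt needs the endpoint `0`. -/
theorem continuous_klBer_left {q : ℝ} (h0 : 0 < q) (h1 : q < 1) :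
    Continuous fun p => klBer p q := by
  have h2 : 1 - q ≠ 0 := by linarith
  have e : (fun p => klBer p q) = fun p => q * ((p / q) * Real.log (p / q))
      + (1 - q) * (((1 - p) / (1 - q)) * Real.log ((1 - p) / (1 - q))) := by
    funext p
    unfold klBer
    field_simp
  rw [e]
  have c1 : Continuous fun p : ℝ => (p / q) * Real.log (p / q) :=
    Real.continuous_mul_log.comp (by fun_prop : Continuous fun p : ℝ => p / q)
  have c2 : Continuous fun p : ℝ => ((1 - p) / (1 - q)) * Real.log ((1 - p) / (1 - q)) :=
    Real.continuous_mul_log.comp (by fun_prop : Continuous fun p : ℝ => (1 - p) / (1 - q))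
  exact (c1.const_mul q).add (c2.const_mul (1 - q))

/-- One exponential tilt controls the lower deviations `s I(p,q) > δ` of an average of `s`
variables of mean `m > q`, with an extra factor from the distance of `q` to `m`. -/
theorem exists_lower_tilt {q m δ : ℝ} {s : ℕ} (hs : 0 < s) (hδ : 0 ≤ δ) (hq : 0 < q)
    (hqm : q ≤ m) (hm : m < 1) :
    ∃ l : ℝ, l ≤ 0 ∧ ∀ p, 0 ≤ p → p < q → δ < s * klBer p q →
      δ + 2 * s * (m - q) ^ 2 ≤ l * (s * p) - s * Real.log (1 - m + m * Real.exp l) := by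
  have hs' : (0 : ℝ) < s := by exact_mod_cast hs
  have hq1 : q < 1 := hqm.trans_lt hm
  -- Solve `s I(x,q) = δ` for `x` in `[0,q]` and use the optimal tilt of `x` against `m`. Every
  -- relevant `p` lies below `x`, and a nonpositive tilt only gains there, so a single tilt serves
  -- all of them.
  by_cases h0 : δ < s * klBer 0 q
  · have hc : ContinuousOn (fun p => s * klBer p q) (Set.Icc 0 q) :=
      ((continuous_klBer_left hq hq1).const_mul (s : ℝ)).continuousOn
    obtain ⟨x, hx, hxe⟩ := intermediate_value_Icc' hq.le hc
      (show δ ∈ Set.Icc _ _ from ⟨by simpa [klBer_self hq1] using hδ, h0.le⟩)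
    simp only at hxe
    have hx0 : 0 < x := by
      rcases hx.1.eq_or_lt with rfl | h
      · linarith
      · exact h
    have hxm : x ≤ m := hx.2.trans hqm
    refine ⟨_, tilt_nonpos hx0 hxm hm, fun p hp hpq hlt => ?_⟩
    have hpx : p ≤ x := by
      by_contra hcon
      have := klBer_anti_left hx.1 (not_le.1 hcon).le hpq.le hq1
      nlinarith
    have e := klBer_eq_tilt hx0 (hxm.trans_lt hm) (hx0.trans_le hxm) hm
    have ht := tilt_nonpos hx0 hxm hm
    have h2 := klBer_add_sq_le hx.1 hx.2 hqm hm
    set l := Real.log (x * (1 - m) / (m * (1 - x)))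
    have h3 : l * x ≤ l * p := mul_le_mul_of_nonpos_left hpx ht
    have h4 : (s : ℝ) * (klBer x q + 2 * (m - q) ^ 2)
        ≤ s * (l * p - Real.log (1 - m + m * Real.exp l)) := by
      apply mul_le_mul_of_nonneg_left _ hs'.le
      linarith
    linarith
  -- Here no `p` in `[0,q)` can deviate that much, so the tilt is immaterial.
  · refine ⟨0, le_rfl, fun p hp hpq hlt => absurd ?_ h0⟩
    exact hlt.trans_le (mul_le_mul_of_nonneg_left (klBer_anti_left le_rfl hp hpq.le hq1) hs'.le)

/-- The index exceeds the empirical mean by at most the Pinsker radius. -/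
theorem klIndex_le {c p : ℝ} {s n : ℕ} (hp : 0 ≤ p) (hs : 0 < s) :
    klIndex c p s n
      ≤ p + √((Real.log n + c * Real.log (Real.log n)) / (2 * s)) := by
  have hs' : (0 : ℝ) < s := by exact_mod_cast hs
  unfold klIndex
  split_ifs with h
  · rcases h with h | h
    · omega
    · rw [h]; linarith [Real.sqrt_nonneg ((Real.log n + c * Real.log (Real.log n)) / (2 * s))]
  · apply Real.sSup_le
    · rintro q ⟨hpq, hq1, hq⟩
      have h2 := two_mul_sq_le_klBer hp hpq hq1
      have : q - p ≤ √((Real.log n + c * Real.log (Real.log n)) / (2 * s)) := by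
        apply Real.le_sqrt_of_sq_le
        rw [le_div_iff₀ (by positivity)]
        nlinarith
      linarith
    · positivity

/-- Nonnegativity of the exploration level makes the empirical mean admissible in the supremum, so
the mean lies below `q`; then `q` itself must violate the constraint. The conventional value `1` is
excluded by `q < 1`. -/
theorem klBer_gt_of_klIndex_lt {c p q : ℝ} {s n : ℕ} (hp1 : p ≤ 1) (hq : q < 1)
    (hδ : 0 ≤ Real.log n + c * Real.log (Real.log n)) (h : klIndex c p s n < q) :
    0 < s ∧ p < q ∧ Real.log n + c * Real.log (Real.log n) < s * klBer p q := by
  unfold klIndex at h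
  split_ifs at h with h1
  · linarith
  · push Not at h1
    have hbdd : BddAbove {q : ℝ | p ≤ q ∧ q < 1 ∧
        (s : ℝ) * klBer p q ≤ Real.log n + c * Real.log (Real.log n)} :=
      ⟨1, fun y hy => hy.2.1.le⟩
    have hp1' : p < 1 := lt_of_le_of_ne hp1 h1.2
    have hpq : p < q :=
      (le_csSup hbdd ⟨le_rfl, hp1', by rw [klBer_self hp1']; simpa using hδ⟩).trans_lt h
    refine ⟨Nat.pos_of_ne_zero h1.1, hpq, ?_⟩
    by_contra hcon
    exact absurd (le_csSup hbdd ⟨hpq.le, hq, not_lt.1 hcon⟩) (not_le.2 h)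

/-! ### Filtration of the rewards and predictability of the selected arms -/

section Past

variable {K : ℕ} {Ω : Type*}

/-- The σ-algebra generated by the rewards of all arms in rounds `1, …, n`. -/
@[reducible] def past (X : Fin K → ℕ → Ω → ℝ) (n : ℕ) : MeasurableSpace Ω :=
  ⨆ p ∈ {p : Fin K × ℕ | p.2 + 1 ≤ n}, MeasurableSpace.comap (X p.1 (p.2 + 1)) inferInstance

theorem past_mono (X : Fin K → ℕ → Ω → ℝ) {n m : ℕ} (h : n ≤ m) : past X n ≤ past X m :=
  biSup_mono fun _ hp => le_trans hp h

theorem measurable_past (X : Fin K → ℕ → Ω → ℝ) (i : Fin K) {t n : ℕ} (h1 : 1 ≤ t)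
    (h : t ≤ n) : Measurable[past X n] (X i t) := by
  obtain ⟨t, rfl⟩ : ∃ s, t = s + 1 := ⟨t - 1, by omega⟩
  rw [measurable_iff_comap_le]
  exact le_biSup (fun p : Fin K × ℕ => MeasurableSpace.comap (X p.1 (p.2 + 1)) inferInstance)
    (show ((i, t) : Fin K × ℕ) ∈ {p : Fin K × ℕ | p.2 + 1 ≤ n} from h)

/-- By strong induction the observed history is contained in the σ-algebra of all past rewards,
observed or not; the latter is independent of the current reward by construction. -/
theorem IsSWKLUCB.measurable_arm {c : ℝ} {τ : ℕ} {X : Fin K → ℕ → Ω → ℝ} {k : ℕ → Ω → Fin K}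
    (h : IsSWKLUCB c τ X k) : ∀ n, 1 ≤ n → Measurable[past X (n - 1)] (k n) := by
  intro n
  induction n using Nat.strong_induction_on with
  | _ n ih =>
    intro hn
    refine (h.adapted n hn).mono ?_ le_rfl
    refine iSup₂_le fun t ht => ?_
    rw [Finset.mem_Icc] at ht
    rw [← measurable_iff_comap_le]
    have hk : Measurable[past X (n - 1)] (k t) :=
      (ih t (by omega) ht.1).mono (past_mono X (by omega)) le_rfl
    refine Measurable.prodMk hk ?_
    have hX : ∀ i, Measurable[past X (n - 1)] (X i t) := fun i => measurable_past X i ht.1 ht.2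
    have e : (fun ω => X (k t ω) t ω) = fun ω => ∑ i, if k t ω = i then X i t ω else 0 := by
      funext ω
      simp
    rw [e]
    refine Finset.measurable_sum _ fun i _ => ?_
    exact Measurable.ite (hk (measurableSet_singleton i)) (hX i) measurable_const

variable [MeasurableSpace Ω] {P : Measure Ω} {X : Fin K → ℕ → Ω → ℝ}

theorem IsRewardProcess.past_le (h : IsRewardProcess P X) (n : ℕ) :
    past X n ≤ ‹MeasurableSpace Ω› :=
  iSup₂_le fun p _ => (h.measurable p.1 (p.2 + 1) (by omega)).comap_le

theorem IsRewardProcess.indep_past (h : IsRewardProcess P X) (i : Fin K) {n : ℕ} (hn : 1 ≤ n) :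
    Indep (past X (n - 1)) (MeasurableSpace.comap (X i n) inferInstance) P := by
  have key := indep_iSup_of_disjoint
    (fun p : Fin K × ℕ => (h.measurable p.1 (p.2 + 1) (by omega)).comap_le) h.indep
    (S := {p : Fin K × ℕ | p.2 + 1 ≤ n - 1}) (T := {(i, n - 1)})
    (by
      rw [Set.disjoint_singleton_right]
      simp)
  rw [iSup_singleton] at key
  simp only [Nat.sub_add_cancel hn] at key
  exact key

theorem IsRewardProcess.integrable (h : IsRewardProcess P X) [IsProbabilityMeasure P]
    (i : Fin K) {n : ℕ} (hn : 1 ≤ n) : Integrable (X i n) P :=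
  Integrable.of_mem_Icc 0 1 (h.measurable i n hn).aemeasurable (h.mem_Icc i n hn)

theorem IsRewardProcess.meanReward_mem (h : IsRewardProcess P X) [IsProbabilityMeasure P]
    (i : Fin K) {n : ℕ} (hn : 1 ≤ n) : meanReward P X i n ∈ Set.Icc (0 : ℝ) 1 := by
  constructor
  · exact integral_nonneg_of_ae ((h.mem_Icc i n hn).mono fun ω hω => hω.1)
  · calc meanReward P X i n ≤ ∫ _, (1 : ℝ) ∂P :=
        integral_mono_ae (h.integrable i hn) (integrable_const _)
          ((h.mem_Icc i n hn).mono fun ω hω => hω.2)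
      _ = 1 := by simp

end Past

/-! ### Exponential supermartingales along predictable selections -/

section Product

variable {K : ℕ} {Ω : Type*}

open Classical in
/-- Product over the rounds `t ∈ [l, r)` with `ω ∈ J t` of the factors `g t (X i t)`. -/
def selProd (X : Fin K → ℕ → Ω → ℝ) (i : Fin K) (J : ℕ → Set Ω) (g : ℕ → ℝ → ℝ) (l r : ℕ)
    (ω : Ω) : ℝ :=
  ∏ t ∈ Finset.Ico l r, if ω ∈ J t then g t (X i t ω) else 1

theorem selProd_exp {X : Fin K → ℕ → Ω → ℝ} {i : Fin K} {J : ℕ → Set Ω} (f : ℕ → ℝ → ℝ)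
    {l r : ℕ} {ω : Ω} {S : Finset ℕ} (hS : ∀ t, t ∈ S ↔ (l ≤ t ∧ t < r) ∧ ω ∈ J t) :
    selProd X i J (fun t x => Real.exp (f t x)) l r ω = Real.exp (∑ t ∈ S, f t (X i t ω)) := by
  classical
  unfold selProd
  have : S = (Finset.Ico l r).filter fun t => ω ∈ J t := by
    ext t
    simp [hS]
  rw [Real.exp_sum, this, Finset.prod_filter]

theorem selProd_nonneg (X : Fin K → ℕ → Ω → ℝ) (i : Fin K) (J : ℕ → Set Ω) {g : ℕ → ℝ → ℝ}
    (hg : ∀ t x, 0 ≤ g t x) (l r : ℕ) (ω : Ω) : 0 ≤ selProd X i J g l r ω := by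
  refine Finset.prod_nonneg fun t _ => ?_
  split_ifs
  · exact hg _ _
  · exact zero_le_one

variable [MeasurableSpace Ω] {P : Measure Ω} {X : Fin K → ℕ → Ω → ℝ}

/-- A product of factors of mean at most one, over a predictable set of rounds, has mean at most
one. -/
theorem IsRewardProcess.selProd_le_one (h : IsRewardProcess P X) [IsProbabilityMeasure P]
    (i : Fin K) (J : ℕ → Set Ω) (g : ℕ → ℝ → ℝ) {l : ℕ} (hl : 1 ≤ l) (r : ℕ)
    (hJ : ∀ t, l ≤ t → t < r → MeasurableSet[past X (t - 1)] (J t))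
    (hg : ∀ t, Measurable (g t)) (hg0 : ∀ t x, 0 ≤ g t x)
    (hgi : ∀ t, l ≤ t → t < r → Integrable (fun ω => g t (X i t ω)) P)
    (hg1 : ∀ t, l ≤ t → t < r → ∫ ω, g t (X i t ω) ∂P ≤ 1) :
    Measurable[past X (r - 1)] (selProd X i J g l r) ∧ Integrable (selProd X i J g l r) P ∧
      ∫ ω, selProd X i J g l r ω ∂P ≤ 1 := by
  classical
  induction r with
  | zero =>
    have e : selProd X i J g l 0 = fun _ => 1 := by
      funext ω; simp [selProd]
    rw [e]
    exact ⟨measurable_const, integrable_const _, by simp⟩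
  | succ r ih =>
    by_cases hlr : l ≤ r
    · obtain ⟨m1, m2, m3⟩ := ih (fun t h1 h2 => hJ t h1 (by omega))
        (fun t h1 h2 => hgi t h1 (by omega)) (fun t h1 h2 => hg1 t h1 (by omega))
      set Z := selProd X i J g l r with hZ
      have hJr := hJ r hlr (by omega)
      have hle := h.past_le (X := X)
      -- Off `J r` the product is unchanged; on `J r` the new factor is independent of the past and
      -- has mean at most one.
      have e : selProd X i J g l (r + 1) = fun ω =>
          (J r)ᶜ.indicator Z ω + (J r).indicator Z ω * g r (X i r ω) := by
        funext ω
        simp only [hZ, selProd, Finset.prod_Ico_succ_top hlr]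
        by_cases hω : ω ∈ J r <;> simp [hω, selProd]
      have hmJ : Measurable[past X (r - 1)] ((J r).indicator Z) := m1.indicator hJr
      have hmg : Measurable (fun ω => g r (X i r ω)) :=
        (hg r).comp (h.measurable i r (by omega))
      have hind : IndepFun ((J r).indicator Z) (fun ω => g r (X i r ω)) P := by
        rw [IndepFun_iff_Indep]
        refine indep_of_indep_of_le_left (indep_of_indep_of_le_right
          (h.indep_past i (n := r) (by omega)) ?_) hmJ.comap_le
        rw [← measurable_iff_comap_le]
        exact (hg r).comp (comap_measurable (X i r))
      have hI1 : Integrable ((J r)ᶜ.indicator Z) P := m2.indicator (hle _ _ hJr).compl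
      have hI2 : Integrable ((J r).indicator Z) P := m2.indicator (hle _ _ hJr)
      have hI3 : Integrable (fun ω => (J r).indicator Z ω * g r (X i r ω)) P :=
        hind.integrable_mul hI2 (hgi r hlr (by omega))
      rw [e]
      refine ⟨?_, hI1.add hI3, ?_⟩
      · have hp := past_mono X (show r - 1 ≤ r + 1 - 1 by omega)
        refine Measurable.add ?_ (Measurable.mul ?_ ?_)
        · exact (m1.indicator hJr.compl).mono hp le_rfl
        · exact hmJ.mono hp le_rfl
        · exact (hg r).comp (measurable_past X i (by omega) (by omega))
      · have e2 : ∫ ω, (J r).indicator Z ω * g r (X i r ω) ∂P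
            = (∫ ω, (J r).indicator Z ω ∂P) * ∫ ω, g r (X i r ω) ∂P :=
          hind.integral_mul_eq_mul_integral hI2.aestronglyMeasurable hmg.aestronglyMeasurable
        rw [integral_add hI1 hI3, e2]
        have h0 : 0 ≤ ∫ ω, (J r).indicator Z ω ∂P :=
          integral_nonneg fun ω => Set.indicator_nonneg (fun ω _ => selProd_nonneg X i J hg0 l r ω) ω
        have h1 := mul_le_of_le_one_right h0 (hg1 r hlr (by omega))
        have h2 : ∫ ω, (J r)ᶜ.indicator Z ω ∂P + ∫ ω, (J r).indicator Z ω ∂P = ∫ ω, Z ω ∂P := by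
          rw [← integral_add hI1 hI2]
          exact integral_congr_ae (.of_forall fun ω => Set.indicator_compl_add_self_apply _ _ _)
        linarith
    · have e : selProd X i J g l (r + 1) = fun _ => 1 := by
        funext ω
        simp [selProd, Finset.Ico_eq_empty_of_le (show r + 1 ≤ l by omega)]
      rw [e]
      exact ⟨measurable_const, integrable_const _, by simp⟩

theorem IsRewardProcess.integrable_exp_mul (h : IsRewardProcess P X) [IsProbabilityMeasure P]
    (i : Fin K) {n : ℕ} (hn : 1 ≤ n) (l : ℝ) :
    Integrable (fun ω => Real.exp (l * X i n ω)) P :=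
  integrable_exp_mul_of_mem_Icc (h.measurable i n hn).aemeasurable (h.mem_Icc i n hn)

/-- Exponential supermartingale of Hoeffding's inequality, for the sum over selected rounds. -/
theorem IsRewardProcess.hoeffding_selProd (h : IsRewardProcess P X) [IsProbabilityMeasure P]
    (i : Fin K) (J : ℕ → Set Ω) (v : ℝ) {l : ℕ} (hl : 1 ≤ l) (r : ℕ)
    (hJ : ∀ t, l ≤ t → t < r → MeasurableSet[past X (t - 1)] (J t)) :
    Integrable (selProd X i J
        (fun t x => Real.exp (v * (x - meanReward P X i t) - v ^ 2 / 8)) l r) P ∧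
      ∫ ω, selProd X i J
        (fun t x => Real.exp (v * (x - meanReward P X i t) - v ^ 2 / 8)) l r ω ∂P ≤ 1 := by
  refine (h.selProd_le_one i J _ hl r hJ (fun t => by fun_prop) (fun t x => (Real.exp_pos _).le)
    ?_ ?_).2
  · intro t h1 _
    have := (h.integrable_exp_mul i (hl.trans h1) v).mul_const
      (Real.exp (-(v * meanReward P X i t) - v ^ 2 / 8))
    refine this.congr (.of_forall fun ω => ?_)
    simp only [← Real.exp_add]
    congr 1
    ring
  · intro t h1 _
    have hs := (hasSubgaussianMGF_of_mem_Icc (h.measurable i t (hl.trans h1)).aemeasurable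
      (h.mem_Icc i t (hl.trans h1))).mgf_le v
    have e : ∫ ω, Real.exp (v * (X i t ω - meanReward P X i t) - v ^ 2 / 8) ∂P
        = (∫ ω, Real.exp (v * (X i t ω - meanReward P X i t)) ∂P) * Real.exp (-(v ^ 2 / 8)) := by
      rw [← integral_mul_const]
      refine integral_congr_ae (.of_forall fun ω => ?_)
      simp only [← Real.exp_add, sub_eq_add_neg]
    rw [e]
    unfold mgf at hs
    have h2 : (∫ ω, Real.exp (v * (X i t ω - meanReward P X i t)) ∂P) ≤ Real.exp (v ^ 2 / 8) := by
      refine hs.trans (le_of_eq ?_)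
      congr 1
      simp
      ring
    calc _ ≤ Real.exp (v ^ 2 / 8) * Real.exp (-(v ^ 2 / 8)) :=
          mul_le_mul_of_nonneg_right h2 (Real.exp_pos _).le
      _ = 1 := by rw [← Real.exp_add]; simp

/-- Exponential supermartingale of the Chernoff bound for lower deviations. -/
theorem IsRewardProcess.chernoff_selProd (h : IsRewardProcess P X) [IsProbabilityMeasure P]
    (i : Fin K) (J : ℕ → Set Ω) {v m : ℝ} (hv : v ≤ 0) (hm0 : 0 ≤ m) (hm1 : m < 1)
    {l : ℕ} (hl : 1 ≤ l) (r : ℕ)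
    (hm : ∀ t, l ≤ t → t < r → m ≤ meanReward P X i t)
    (hJ : ∀ t, l ≤ t → t < r → MeasurableSet[past X (t - 1)] (J t)) :
    Integrable (selProd X i J
        (fun _ x => Real.exp (v * x - Real.log (1 - m + m * Real.exp v))) l r) P ∧
      ∫ ω, selProd X i J
        (fun _ x => Real.exp (v * x - Real.log (1 - m + m * Real.exp v))) l r ω ∂P ≤ 1 := by
  have hpos : 0 < 1 - m + m * Real.exp v := by
    have := mul_nonneg hm0 (Real.exp_pos v).le
    linarith
  have e : ∀ x, Real.exp (v * x - Real.log (1 - m + m * Real.exp v))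
      = Real.exp (v * x) * (1 - m + m * Real.exp v)⁻¹ := by
    intro x
    rw [Real.exp_sub, Real.exp_log hpos, div_eq_mul_inv]
  refine (h.selProd_le_one i J _ hl r hJ (fun t => by fun_prop) (fun t x => (Real.exp_pos _).le)
    ?_ ?_).2
  · intro t h1 _
    simp only [e]
    exact (h.integrable_exp_mul i (hl.trans h1) v).mul_const _
  · intro t h1 h2
    have ht : 1 ≤ t := hl.trans h1
    simp only [e]
    rw [integral_mul_const, ← div_eq_mul_inv, div_le_one hpos]
    have hXi := h.integrable i ht
    -- Convexity bounds `exp(vX)` by its chord on `[0,1]`. Since `v ≤ 0`, the result decreases in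
    -- the mean, so a common lower bound `m` handles varying means.
    calc ∫ ω, Real.exp (v * X i t ω) ∂P
        ≤ ∫ ω, (1 + (Real.exp v - 1) * X i t ω) ∂P := by
          refine integral_mono_ae (h.integrable_exp_mul i ht v)
            ((integrable_const _).add (hXi.const_mul _)) ?_
          filter_upwards [h.mem_Icc i t ht] with ω hω
          have := convexOn_exp.2 (Set.mem_univ 0) (Set.mem_univ v)
            (show 0 ≤ 1 - X i t ω by linarith [hω.2]) hω.1 (by ring)
          simp only [smul_eq_mul, mul_zero, zero_add, Real.exp_zero, mul_one] at this
          rw [mul_comm v]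
          linarith
      _ = 1 + (Real.exp v - 1) * meanReward P X i t := by
          rw [integral_add (integrable_const _) (hXi.const_mul _), integral_const_mul]
          simp [meanReward]
      _ ≤ 1 - m + m * Real.exp v := by
          have h3 := hm t h1 h2
          have h4 : Real.exp v ≤ 1 := Real.exp_le_one_iff.2 hv
          nlinarith

end Product

/-! ### Selections of an arm in a time interval -/

section Pulls

variable {K : ℕ} {Ω : Type*}

/-- The rounds of `[l, r)` in which arm `i` was selected. -/
def pulls (k : ℕ → Ω → Fin K) (i : Fin K) (l r : ℕ) (ω : Ω) : Finset ℕ :=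
  {t ∈ Finset.Ico l r | k t ω = i}

theorem mem_pulls {k : ℕ → Ω → Fin K} {i : Fin K} {l r t : ℕ} {ω : Ω} :
    t ∈ pulls k i l r ω ↔ (l ≤ t ∧ t < r) ∧ k t ω = i := by
  simp [pulls]

theorem windowPulls_eq (τ : ℕ) (k : ℕ → Ω → Fin K) (i : Fin K) (n : ℕ) (ω : Ω) :
    windowPulls τ k i n ω = pulls k i (max 1 (n - τ)) n ω := by
  ext t
  simp only [windowPulls, pulls, Finset.mem_filter, Finset.mem_Ico, max_le_iff]
  constructor
  · rintro ⟨⟨h1, h2⟩, h3, h4⟩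
    exact ⟨⟨⟨h1, by omega⟩, h2⟩, h4⟩
  · rintro ⟨⟨⟨h1, h3⟩, h2⟩, h4⟩
    exact ⟨⟨h1, h2⟩, by omega, h4⟩

theorem sum_pulls_append (k : ℕ → Ω → Fin K) (i : Fin K) {l b r : ℕ} (h1 : l ≤ b) (h2 : b ≤ r)
    (ω : Ω) (f : ℕ → ℝ) :
    ∑ t ∈ pulls k i l r ω, f t = ∑ t ∈ pulls k i l b ω, f t + ∑ t ∈ pulls k i b r ω, f t := by
  simp only [pulls, Finset.sum_filter]
  rw [Finset.sum_Ico_consecutive _ h1 h2]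

theorem card_pulls_append (k : ℕ → Ω → Fin K) (i : Fin K) {l b r : ℕ} (h1 : l ≤ b) (h2 : b ≤ r)
    (ω : Ω) :
    ((pulls k i l r ω).card : ℝ) = (pulls k i l b ω).card + (pulls k i b r ω).card := by
  simpa using sum_pulls_append k i h1 h2 ω (fun _ => 1)

theorem card_pulls_mono (k : ℕ → Ω → Fin K) (i : Fin K) (l : ℕ) {r r' : ℕ} (h : r ≤ r') (ω : Ω) :
    (pulls k i l r ω).card ≤ (pulls k i l r' ω).card := by
  refine Finset.card_le_card fun t ht => ?_
  rw [mem_pulls] at ht ⊢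
  exact ⟨⟨ht.1.1, by omega⟩, ht.2⟩

/-- Round `r` itself is counted on the right only. This makes the count of earlier selections an
injective label of the selections in a block. -/
theorem card_pulls_lt {k : ℕ → Ω → Fin K} {i : Fin K} {l r r' : ℕ} (hl : l ≤ r) (h : r < r')
    {ω : Ω} (hr : k r ω = i) :
    (pulls k i l r ω).card < (pulls k i l r' ω).card := by
  refine Finset.card_lt_card ⟨fun t ht => ?_, fun hss => ?_⟩
  · rw [mem_pulls] at ht ⊢
    exact ⟨⟨ht.1.1, by omega⟩, ht.2⟩
  · have := hss (mem_pulls.2 ⟨⟨hl, h⟩, hr⟩)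
    rw [mem_pulls] at this
    omega

theorem IsSWKLUCB.measurableSet_eq {c : ℝ} {τ : ℕ} {X : Fin K → ℕ → Ω → ℝ} {k : ℕ → Ω → Fin K}
    (h : IsSWKLUCB c τ X k) (i : Fin K) {t n : ℕ} (ht : 1 ≤ t) (hn : t ≤ n) :
    MeasurableSet[past X (n - 1)] {ω | k t ω = i} :=
  past_mono X (Nat.sub_le_sub_right hn 1) _ (h.measurable_arm t ht (measurableSet_singleton i))

theorem IsSWKLUCB.measurable_card_pulls {c : ℝ} {τ : ℕ} {X : Fin K → ℕ → Ω → ℝ}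
    {k : ℕ → Ω → Fin K} (h : IsSWKLUCB c τ X k) (i : Fin K) {l n : ℕ} (hl : 1 ≤ l) :
    Measurable[past X (n - 1)] fun ω => (pulls k i l n ω).card := by
  simp only [pulls, Finset.card_filter]
  refine Finset.measurable_sum _ fun t ht => ?_
  rw [Finset.mem_Ico] at ht
  exact Measurable.ite (h.measurableSet_eq i (hl.trans ht.1) ht.2.le) measurable_const
    measurable_const

theorem windowMean_mem_Icc {X : Fin K → ℕ → Ω → ℝ} {τ : ℕ} {k : ℕ → Ω → Fin K} {i : Fin K} {n : ℕ} {ω : Ω}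
    (h : ∀ t, 1 ≤ t → X i t ω ∈ Set.Icc (0 : ℝ) 1) :
    windowMean τ X k i n ω ∈ Set.Icc (0 : ℝ) 1 := by
  have h1 : ∀ t ∈ windowPulls τ k i n ω, 1 ≤ t := fun t ht =>
    (Finset.mem_Ico.1 (Finset.mem_filter.1 ht).1).1
  constructor
  · exact div_nonneg (Finset.sum_nonneg fun t ht => (h t (h1 t ht)).1) (Nat.cast_nonneg _)
  · refine div_le_one_of_le₀ ?_ (Nat.cast_nonneg _)
    calc ∑ t ∈ windowPulls τ k i n ω, X i t ω ≤ ∑ t ∈ windowPulls τ k i n ω, (1 : ℝ) :=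
          Finset.sum_le_sum fun t ht => (h t (h1 t ht)).2
      _ = _ := by simp

end Pulls

/-! ### Geometric sums and counting -/

theorem sum_exp_neg_mul_le {a : ℝ} (ha : 0 < a) (n : ℕ) :
    ∑ i ∈ Finset.range n, Real.exp (-(a * i)) ≤ 1 + 1 / a := by
  have h1 : Real.exp (-a) < 1 := by simpa using ha
  have e : ∀ i : ℕ, Real.exp (-(a * i)) = Real.exp (-a) ^ i := by
    intro i
    rw [← Real.exp_nat_mul]
    congr 1
    ring
  simp only [e]
  have h2 : ∑ i ∈ Finset.range n, Real.exp (-a) ^ i ≤ (1 - Real.exp (-a))⁻¹ := by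
    rw [← tsum_geometric_of_lt_one (Real.exp_pos _).le h1]
    exact (summable_geometric_of_lt_one (Real.exp_pos _).le h1).sum_le_tsum _
      fun i _ => by positivity
  refine h2.trans ?_
  have h3 : Real.exp (-a) ≤ 1 / (1 + a) := by
    rw [Real.exp_neg, ← one_div]
    exact one_div_le_one_div_of_le (by linarith) (by linarith [Real.add_one_le_exp a])
  have h4 : a / (1 + a) ≤ 1 - Real.exp (-a) := by
    have : a / (1 + a) = 1 - 1 / (1 + a) := by
      field_simp
      ring
    linarith
  calc (1 - Real.exp (-a))⁻¹ ≤ (a / (1 + a))⁻¹ := inv_anti₀ (by positivity) h4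
    _ = 1 + 1 / a := by
        field_simp
        ring

theorem sum_exp_neg_mul_sub_le {a x : ℝ} (ha : 0 < a) (n : ℕ) :
    ∑ i ∈ Finset.range n with x ≤ ((i : ℕ) : ℝ), Real.exp (-(a * (i - x))) ≤ 1 + 1 / a := by
  calc ∑ i ∈ Finset.range n with x ≤ ((i : ℕ) : ℝ), Real.exp (-(a * (i - x)))
      ≤ ∑ i ∈ Finset.Ico ⌈x⌉₊ (max n ⌈x⌉₊), Real.exp (-(a * (i - x))) := by
        refine Finset.sum_le_sum_of_subset_of_nonneg ?_ fun _ _ _ => (Real.exp_pos _).le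
        intro i hi
        simp only [Finset.mem_filter, Finset.mem_range] at hi
        rw [Finset.mem_Ico]
        exact ⟨Nat.ceil_le.2 hi.2, lt_max_of_lt_left hi.1⟩
    _ = ∑ j ∈ Finset.range (max n ⌈x⌉₊ - ⌈x⌉₊), Real.exp (-(a * ((⌈x⌉₊ + j : ℕ) - x))) := by
        rw [Finset.sum_Ico_eq_sum_range]
    _ ≤ ∑ j ∈ Finset.range (max n ⌈x⌉₊ - ⌈x⌉₊), Real.exp (-(a * j)) := by
        refine Finset.sum_le_sum fun j _ => Real.exp_le_exp.2 ?_
        have := Nat.le_ceil x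
        push_cast
        nlinarith
    _ ≤ 1 + 1 / a := sum_exp_neg_mul_le ha _

theorem card_filter_lt_le {x : ℝ} (hx : 0 ≤ x) (n : ℕ) :
    (((Finset.range n).filter fun i : ℕ => (i : ℝ) < x).card : ℝ) ≤ x + 1 := by
  have : (Finset.range n).filter (fun i : ℕ => (i : ℝ) < x) ⊆ Finset.range ⌈x⌉₊ := by
    intro i hi
    simp only [Finset.mem_filter, Finset.mem_range] at hi ⊢
    exact Nat.lt_ceil.2 hi.2
  have h1 := Finset.card_le_card this
  rw [Finset.card_range] at h1
  have h2 := (Nat.ceil_lt_add_one hx).le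
  exact le_trans (by exact_mod_cast h1) h2

/-! ### Deviations of a single index -/

section Index

variable {K : ℕ} {Ω : Type*} [MeasurableSpace Ω] {P : Measure Ω} {X : Fin K → ℕ → Ω → ℝ}

theorem IsRewardProcess.ae_mem_Icc (h : IsRewardProcess P X) (i : Fin K) :
    ∀ᵐ ω ∂P, ∀ t, 1 ≤ t → X i t ω ∈ Set.Icc (0 : ℝ) 1 := by
  rw [ae_all_iff]
  intro t
  rw [Filter.eventually_imp_distrib_left]
  exact h.mem_Icc i t

/-- The index of an arm whose means over the window are at least `m` rarely falls below `q < m`: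
the indicator of this event is dominated by a variable of small mean. -/
theorem exists_bound_swIndex_lt [IsProbabilityMeasure P] (h : IsRewardProcess P X) {c : ℝ} {τ : ℕ}
    {k : ℕ → Ω → Fin K} (hk : IsSWKLUCB c τ X k) (i : Fin K) {n : ℕ} {q m δ : ℝ}
    (hδ : δ = Real.log τ + c * Real.log (Real.log τ)) (hδ0 : 0 ≤ δ)
    (hqm : q < m) (hm : m < 1)
    (hmean : ∀ t, 1 ≤ t → t < n → n ≤ t + τ → m ≤ meanReward P X i t) :
    ∃ Y : Ω → ℝ, Integrable Y P ∧ (∀ ω, 0 ≤ Y ω) ∧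
      ∫ ω, Y ω ∂P ≤ Real.exp (-δ) * (1 + 1 / (2 * (m - q) ^ 2)) ∧
      ∀ᵐ ω ∂P, swIndex c τ X k i n ω < q → 1 ≤ Y ω := by
  classical
  -- For `q ≤ 0` the event is null: the index is at least the empirical mean, which is almost surely
  -- nonnegative.
  rcases le_or_gt q 0 with hq | hq
  · refine ⟨fun _ => 0, integrable_const _, fun _ => le_rfl, ?_, ?_⟩
    · simp only [integral_zero]
      positivity
    · filter_upwards [h.ae_mem_Icc i] with ω hω hlt
      have hp := windowMean_mem_Icc (τ := τ) (k := k) (n := n) hω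
      obtain ⟨-, h2, -⟩ := klBer_gt_of_klIndex_lt hp.2 (hqm.trans hm) (hδ ▸ hδ0) hlt
      linarith [hp.1]
  have hsel : ∀ s : ℕ, ∃ v : ℝ, v ≤ 0 ∧ (0 < s → ∀ p, 0 ≤ p → p < q → δ < s * klBer p q →
      δ + 2 * s * (m - q) ^ 2 ≤ v * (s * p) - s * Real.log (1 - m + m * Real.exp v)) := by
    intro s
    rcases Nat.eq_zero_or_pos s with rfl | hs
    · exact ⟨0, le_rfl, fun h => absurd h (lt_irrefl 0)⟩
    · obtain ⟨v, hv, h1⟩ := exists_lower_tilt hs hδ0 hq hqm.le hm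
      exact ⟨v, hv, fun _ => h1⟩
  choose v hv hvb using hsel
  set l := max 1 (n - τ) with hl
  have hl1 : 1 ≤ l := le_max_left _ _
  have hln : n - τ ≤ l := le_max_right _ _
  set J : ℕ → Set Ω := fun t => {ω | k t ω = i} with hJ
  set Z : ℕ → Ω → ℝ := fun s => selProd X i J
    (fun _ x => Real.exp (v s * x - Real.log (1 - m + m * Real.exp (v s)))) l n with hZ
  have hZi := fun s => h.chernoff_selProd i J (hv s) (hq.trans hqm).le hm hl1 n
    (fun t h1 h2 => hmean t (hl1.trans h1) h2 (by omega))
    (fun t h1 _ => hk.measurableSet_eq i (hl1.trans h1) le_rfl)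
  have hZ0 : ∀ s ω, 0 ≤ Z s ω :=
    fun s ω => selProd_nonneg X i J (fun _ _ => (Real.exp_pos _).le) l n ω
  have hsq : 0 < 2 * (m - q) ^ 2 := by
    have : 0 < m - q := by linarith
    positivity
  -- The number of selections is random and depends on the rewards, so the bound sums over all its
  -- values; only the term with the true count is needed to reach `1`.
  refine ⟨fun ω => ∑ s ∈ Finset.range (n + 1), Real.exp (-δ - 2 * s * (m - q) ^ 2) * Z s ω,
    integrable_finsetSum _ fun s _ => (hZi s).1.const_mul _,
    fun ω => Finset.sum_nonneg fun s _ => mul_nonneg (Real.exp_pos _).le (hZ0 s ω), ?_, ?_⟩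
  · rw [integral_finsetSum _ fun s _ => (hZi s).1.const_mul _]
    calc ∑ s ∈ Finset.range (n + 1), ∫ ω, Real.exp (-δ - 2 * s * (m - q) ^ 2) * Z s ω ∂P
        ≤ ∑ s ∈ Finset.range (n + 1), Real.exp (-δ) * Real.exp (-(2 * (m - q) ^ 2 * s)) := by
          refine Finset.sum_le_sum fun s _ => ?_
          rw [integral_const_mul, ← Real.exp_add]
          calc _ ≤ Real.exp (-δ - 2 * s * (m - q) ^ 2) * 1 :=
                mul_le_mul_of_nonneg_left (hZi s).2 (Real.exp_pos _).le
            _ = _ := by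
                rw [mul_one]
                congr 1
                ring
      _ ≤ _ := by
          rw [← Finset.mul_sum]
          exact mul_le_mul_of_nonneg_left (sum_exp_neg_mul_le hsq _) (Real.exp_pos _).le
  · filter_upwards [h.ae_mem_Icc i] with ω hω hlt
    have hp := windowMean_mem_Icc (τ := τ) (k := k) (n := n) hω
    obtain ⟨h1, h2, h3⟩ := klBer_gt_of_klIndex_lt hp.2 (hqm.trans hm) (hδ ▸ hδ0) hlt
    rw [← hδ] at h3
    set s := (windowPulls τ k i n ω).card with hs
    have hsn : s ∈ Finset.range (n + 1) := by
      have : s ≤ (Finset.Ico 1 n).card := Finset.card_le_card (Finset.filter_subset _ _)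
      rw [Nat.card_Ico] at this
      rw [Finset.mem_range]
      omega
    refine le_trans ?_ (Finset.single_le_sum
      (f := fun s : ℕ => Real.exp (-δ - 2 * s * (m - q) ^ 2) * Z s ω)
      (fun s _ => mul_nonneg (Real.exp_pos _).le (hZ0 s ω)) hsn)
    have hb := hvb s h1 _ hp.1 h2 h3
    have hf : ∀ t, t ∈ windowPulls τ k i n ω ↔ (l ≤ t ∧ t < n) ∧ ω ∈ J t := by
      intro t
      rw [windowPulls_eq, mem_pulls]
      rfl
    simp only [hZ]
    rw [selProd_exp _ hf, ← Real.exp_add, Real.one_le_exp_iff, Finset.sum_sub_distrib,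
      ← Finset.mul_sum, Finset.sum_const, nsmul_eq_mul, ← hs]
    have hs0 : (s : ℝ) ≠ 0 := by exact_mod_cast h1.ne'
    have hsp : (s : ℝ) * windowMean τ X k i n ω = ∑ t ∈ windowPulls τ k i n ω, X i t ω := by
      unfold windowMean
      rw [← hs]
      field_simp
    rw [hsp] at hb
    linarith

/-- An index above the window means by `47/48 D` forces a large noise in the observations. -/
theorem noise_ge_of_le_swIndex {c : ℝ} {τ : ℕ} {k : ℕ → Ω → Fin K} {i : Fin K} {n : ℕ}
    {q δ D : ℝ} {ω : Ω} (hδ : δ = Real.log τ + c * Real.log (Real.log τ)) (hδ0 : 0 ≤ δ)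
    (hD : 0 < D) (hω : ∀ t, 1 ≤ t → X i t ω ∈ Set.Icc (0 : ℝ) 1)
    (hmean : ∀ t, 1 ≤ t → t < n → n ≤ t + τ → meanReward P X i t + 47 / 48 * D ≤ q)
    (hN : 0 < (windowPulls τ k i n ω).card) (hidx : q ≤ swIndex c τ X k i n ω) :
    31 / 48 * D * (windowPulls τ k i n ω).card - 3 * δ / (8 * D)
      ≤ ∑ t ∈ windowPulls τ k i n ω, (X i t ω - meanReward P X i t) := by
  have hp := windowMean_mem_Icc (τ := τ) (k := k) (n := n) hω
  have h1 := hidx.trans (klIndex_le hp.1 hN)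
  rw [← hδ] at h1
  have hsum : ∑ t ∈ windowPulls τ k i n ω, meanReward P X i t
      ≤ ∑ t ∈ windowPulls τ k i n ω, (q - 47 / 48 * D) := by
    refine Finset.sum_le_sum fun t ht => ?_
    simp only [windowPulls, Finset.mem_filter, Finset.mem_Ico] at ht
    linarith [hmean t ht.1.1 ht.1.2 ht.2.1]
  rw [Finset.sum_const, nsmul_eq_mul] at hsum
  rw [Finset.sum_sub_distrib]
  have hN' : (0 : ℝ) < (windowPulls τ k i n ω).card := by exact_mod_cast hN
  have hsp : ((windowPulls τ k i n ω).card : ℝ) * windowMean τ X k i n ω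
      = ∑ t ∈ windowPulls τ k i n ω, X i t ω := by
    unfold windowMean
    field_simp
  rw [← hsp]
  set N : ℝ := ((windowPulls τ k i n ω).card : ℝ)
  -- Arithmetic-geometric mean: four times the product of the right-hand terms is `δ/(2N)`. The
  -- slope left over is `47/48 - 1/3 = 31/48`.
  have h2 : √(δ / (2 * N)) ≤ D / 3 + 3 * δ / (8 * D * N) := by
    apply Real.sqrt_le_iff.2
    refine ⟨by positivity, ?_⟩
    have e : (D / 3 + 3 * δ / (8 * D * N)) ^ 2 - δ / (2 * N)
        = (D / 3 - 3 * δ / (8 * D * N)) ^ 2 := by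
      field_simp
      ring
    nlinarith [sq_nonneg (D / 3 - 3 * δ / (8 * D * N))]
  have h3 : N * q ≤ N * (windowMean τ X k i n ω + (D / 3 + 3 * δ / (8 * D * N))) :=
    mul_le_mul_of_nonneg_left (h1.trans (by linarith)) hN'.le
  have h4 : N * (3 * δ / (8 * D * N)) = 3 * δ / (8 * D) := by field_simp
  nlinarith

end Index

/-! ### Selections of a bad arm within one block -/

section Block

variable {K : ℕ} {Ω : Type*} [MeasurableSpace Ω] {P : Measure Ω} {X : Fin K → ℕ → Ω → ℝ}

/-- Hoeffding domination: if the noise of arm `i` over `[l, b)` exceeds `α N + β`, then the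
exponential supermartingale is large. -/
theorem one_le_hoeffding_selProd {i : Fin K} {J : ℕ → Set Ω} {l r : ℕ} {ω : Ω} {S : Finset ℕ}
    (hS : ∀ t, t ∈ S ↔ (l ≤ t ∧ t < r) ∧ ω ∈ J t) {α β : ℝ} (hα : 0 ≤ α)
    (h : α * S.card + β ≤ ∑ t ∈ S, (X i t ω - meanReward P X i t)) :
    1 ≤ Real.exp (-(8 * α * β)) * selProd X i J
      (fun t x => Real.exp (8 * α * (x - meanReward P X i t) - (8 * α) ^ 2 / 8)) l r ω := by
  rw [selProd_exp _ hS, ← Real.exp_add, Real.one_le_exp_iff, Finset.sum_sub_distrib,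
    ← Finset.mul_sum, Finset.sum_const, nsmul_eq_mul]
  have := mul_le_mul_of_nonneg_left h (show 0 ≤ 8 * α by positivity)
  nlinarith

/-- Number of selections, in a block of `τ` rounds, of an arm whose index exceeds its window means
by `47/48 D`: it is dominated by a variable whose mean is of order `log τ / D²`. -/
theorem exists_bound_block [IsProbabilityMeasure P] (h : IsRewardProcess P X) {c : ℝ} {τ : ℕ}
    {k : ℕ → Ω → Fin K} (hk : IsSWKLUCB c τ X k) (i : Fin K) {b : ℕ} (hb : 1 ≤ b)
    {δ D : ℝ} (hδ : δ = Real.log τ + c * Real.log (Real.log τ)) (hδ0 : 0 < δ)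
    (hτδ : τ * Real.exp (-δ) ≤ 1) (hD : 0 < D) (hD1 : D ≤ 1) (B : ℕ → Prop) (q : ℕ → ℝ)
    (hmean : ∀ n, B n → b ≤ n → ∀ t, 1 ≤ t → t < n → n ≤ t + τ →
      meanReward P X i t + 47 / 48 * D ≤ q n) :
    ∃ Y : Ω → ℝ, Integrable Y P ∧
      ∫ ω, Y ω ∂P ≤ 15 * δ / (16 * D ^ 2) + 1156 / D ^ 2 ∧
      ∀ᵐ ω ∂P, ∀ S : Finset ℕ, (∀ n ∈ S, (b ≤ n ∧ n < b + τ) ∧ B n ∧ k n ω = i ∧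
        q n ≤ swIndex c τ X k i n ω) → (S.card : ℝ) ≤ Y ω := by
  classical
  -- Selections with label below `x` are counted without any estimate. Above `x`, the exponent `8αβ`
  -- beats `δ + D²(a - x)`, because `(107/48)(15/16) > 2`.
  set x : ℝ := 15 * δ / (16 * D ^ 2) with hx
  have hx0 : 0 < x := by positivity
  set l : ℕ → ℕ := fun j => max 1 (b + j - τ) with hl
  set JA : ℕ → Set Ω := fun t => {ω | k t ω = i} with hJA
  -- Stopping after `a` selections in the block makes the product depend on `a` alone, so no union
  -- over the current round is needed.
  set JB : ℕ → ℕ → Set Ω := fun a t => {ω | k t ω = i} ∩ {ω | (pulls k i b t ω).card < a} with hJB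
  set α : ℝ := 31 / 48 * D with hα
  set β : ℕ → ℝ := fun a => 5 / 8 * D * a - 3 * δ / (8 * D) with hβ
  set γ : ℝ := D / 48 with hγ
  set ZA : ℕ → Ω → ℝ := fun j => selProd X i JA
    (fun t x => Real.exp (8 * α * (x - meanReward P X i t) - (8 * α) ^ 2 / 8)) (l j) b with hZA
  set ZB : ℕ → Ω → ℝ := fun a => selProd X i (JB a)
    (fun t x => Real.exp (8 * (γ / 2) * (x - meanReward P X i t) - (8 * (γ / 2)) ^ 2 / 8))
    b (b + τ) with hZB
  have hl1 : ∀ j, 1 ≤ l j := fun j => le_max_left _ _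
  have hZAi := fun j => h.hoeffding_selProd i JA (8 * α) (hl1 j) b
    (fun t h1 _ => hk.measurableSet_eq i ((hl1 j).trans h1) le_rfl)
  have hZBi := fun a => h.hoeffding_selProd i (JB a) (8 * (γ / 2)) hb (b + τ)
    (fun t h1 _ => (hk.measurableSet_eq i (hb.trans h1) le_rfl).inter
      (hk.measurable_card_pulls i hb measurableSet_Iio))
  have hZA0 : ∀ j ω, 0 ≤ ZA j ω := fun j ω =>
    selProd_nonneg X i _ (fun _ _ => (Real.exp_pos _).le) _ _ ω
  have hZB0 : ∀ a ω, 0 ≤ ZB a ω := fun a ω =>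
    selProd_nonneg X i _ (fun _ _ => (Real.exp_pos _).le) _ _ ω
  set A : ℕ → Ω → ℝ := fun a ω =>
    (∑ j ∈ Finset.range τ, Real.exp (-(8 * α * β a)) * ZA j ω)
      + Real.exp (-(8 * (γ / 2) * (γ / 2 * a))) * ZB a ω with hA
  have hAint : ∀ a, Integrable (A a) P := fun a =>
    (integrable_finsetSum _ fun j _ => (hZAi j).1.const_mul _).add ((hZBi a).1.const_mul _)
  have hA0 : ∀ a ω, 0 ≤ A a ω := fun a ω =>
    add_nonneg (Finset.sum_nonneg fun j _ => mul_nonneg (Real.exp_pos _).le (hZA0 j ω))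
      (mul_nonneg (Real.exp_pos _).le (hZB0 a ω))
  have hAle : ∀ a : ℕ, x ≤ a → ∫ ω, A a ω ∂P
      ≤ Real.exp (-(D ^ 2 * (a - x))) + Real.exp (-(2 * γ ^ 2 * a)) := by
    intro a ha
    have e1 : ∫ ω, A a ω ∂P = (∑ j ∈ Finset.range τ, Real.exp (-(8 * α * β a)) * ∫ ω, ZA j ω ∂P)
        + Real.exp (-(8 * (γ / 2) * (γ / 2 * a))) * ∫ ω, ZB a ω ∂P := by
      rw [hA, integral_add (integrable_finsetSum _ fun j _ => (hZAi j).1.const_mul _)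
        ((hZBi a).1.const_mul _), integral_finsetSum _ fun j _ => (hZAi j).1.const_mul _,
        integral_const_mul]
      simp only [integral_const_mul]
      rfl
    rw [e1]
    refine add_le_add ?_ ?_
    · calc ∑ j ∈ Finset.range τ, Real.exp (-(8 * α * β a)) * ∫ ω, ZA j ω ∂P
          ≤ ∑ j ∈ Finset.range τ, Real.exp (-(8 * α * β a)) * 1 :=
            Finset.sum_le_sum fun j _ =>
              mul_le_mul_of_nonneg_left (hZAi j).2 (Real.exp_pos _).le
        _ = τ * Real.exp (-(8 * α * β a)) := by simp
        -- The part of the window before the block depends on the round, through its left end; the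
        -- resulting union over `τ` rounds is absorbed by `exp(-δ) ≤ 1/τ`.
        _ ≤ τ * (Real.exp (-δ) * Real.exp (-(D ^ 2 * (a - x)))) := by
            refine mul_le_mul_of_nonneg_left ?_ (Nat.cast_nonneg _)
            rw [← Real.exp_add, Real.exp_le_exp]
            have e2 : 8 * α * β a = 155 / 48 * (D ^ 2 * a) - 31 / 16 * δ := by
              simp only [hα, hβ]
              field_simp
              ring
            have e3 : D ^ 2 * x = 15 / 16 * δ := by
              rw [hx]
              field_simp
            have e4 : D ^ 2 * x ≤ D ^ 2 * a := mul_le_mul_of_nonneg_left ha (by positivity)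
            rw [e2, mul_sub]
            linarith
        _ = (τ * Real.exp (-δ)) * Real.exp (-(D ^ 2 * (a - x))) := by ring
        _ ≤ 1 * Real.exp (-(D ^ 2 * (a - x))) :=
            mul_le_mul_of_nonneg_right hτδ (Real.exp_pos _).le
        _ = _ := one_mul _
    · calc _ ≤ Real.exp (-(8 * (γ / 2) * (γ / 2 * a))) * 1 :=
            mul_le_mul_of_nonneg_left (hZBi a).2 (Real.exp_pos _).le
        _ = _ := by
            rw [mul_one]
            congr 1
            ring
  refine ⟨fun ω => ∑ a ∈ Finset.range τ, if x ≤ a then A a ω else 1, ?_, ?_, ?_⟩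
  · refine integrable_finsetSum _ fun a _ => ?_
    split_ifs
    · exact hAint a
    · exact integrable_const _
  · rw [integral_finsetSum]
    · have e : ∀ a : ℕ, ∫ ω, (if x ≤ a then A a ω else 1) ∂P
          = if x ≤ a then ∫ ω, A a ω ∂P else 1 := by
        intro a
        split_ifs <;> simp
      simp only [e]
      rw [Finset.sum_ite]
      have s1 : ∑ a ∈ Finset.range τ with x ≤ ((a : ℕ) : ℝ), ∫ ω, A a ω ∂P
          ≤ (1 + 1 / D ^ 2) + (1 + 1 / (2 * γ ^ 2)) := by
        calc _ ≤ ∑ a ∈ Finset.range τ with x ≤ ((a : ℕ) : ℝ),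
              (Real.exp (-(D ^ 2 * (a - x))) + Real.exp (-(2 * γ ^ 2 * a))) :=
              Finset.sum_le_sum fun a ha => hAle a (Finset.mem_filter.1 ha).2
          _ ≤ _ := by
              rw [Finset.sum_add_distrib]
              refine add_le_add (sum_exp_neg_mul_sub_le (by positivity) _) ?_
              refine le_trans (Finset.sum_le_sum_of_subset_of_nonneg (Finset.filter_subset _ _)
                fun _ _ _ => (Real.exp_pos _).le) (sum_exp_neg_mul_le (by positivity) τ)
      have s2 : ∑ a ∈ Finset.range τ with ¬ x ≤ ((a : ℕ) : ℝ), (1 : ℝ) ≤ x + 1 := by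
        rw [Finset.sum_const, nsmul_eq_mul, mul_one]
        simp only [not_le]
        exact card_filter_lt_le hx0.le τ
      have s3 : 1 / (2 * γ ^ 2) = 1152 * (1 / D ^ 2) := by
        rw [hγ]
        field_simp
        norm_num
      have s4 : 1 ≤ 1 / D ^ 2 := by
        rw [le_div_iff₀ (by positivity)]
        nlinarith
      have s5 : 1156 / D ^ 2 = 1156 * (1 / D ^ 2) := by ring
      rw [s3] at s1
      rw [s5]
      linarith
    · intro a _
      split_ifs
      · exact hAint a
      · exact integrable_const _
  · filter_upwards [h.ae_mem_Icc i] with ω hω S hS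
    have hinj : Set.InjOn (fun n => (pulls k i b n ω).card) S := by
      have aux : ∀ n ∈ S, ∀ n' ∈ S, n < n' →
          (pulls k i b n ω).card < (pulls k i b n' ω).card := fun n hn n' _ hlt =>
        card_pulls_lt (hS n hn).1.1 hlt (hS n hn).2.2.1
      intro n hn n' hn' he
      simp only at he
      rcases lt_trichotomy n n' with hlt | rfl | hlt
      · exact absurd he (aux n hn n' hn' hlt).ne
      · rfl
      · exact absurd he (aux n' hn' n hn hlt).ne'
    have hcard : S.card = (S.image fun n => (pulls k i b n ω).card).card :=
      (Finset.card_image_of_injOn hinj).symm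
    have hsub : (S.image fun n => (pulls k i b n ω).card) ⊆ Finset.range τ := by
      intro a ha
      obtain ⟨n, hn, rfl⟩ := Finset.mem_image.1 ha
      have h1 := (hS n hn).1
      have h2 : (pulls k i b n ω).card ≤ (Finset.Ico b n).card :=
        Finset.card_le_card (Finset.filter_subset _ _)
      rw [Nat.card_Ico] at h2
      rw [Finset.mem_range]
      omega
    rw [hcard, ← nsmul_one, nsmul_eq_mul, ← nsmul_eq_mul, ← Finset.sum_const]
    refine le_trans (Finset.sum_le_sum (g := fun a : ℕ => if x ≤ a then A a ω else 1) ?_)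
      (Finset.sum_le_sum_of_subset_of_nonneg hsub fun a _ _ => ?_)
    · intro a ha
      obtain ⟨n, hn, rfl⟩ := Finset.mem_image.1 ha
      obtain ⟨⟨hn1, hn2⟩, hBn, hkn, hqn⟩ := hS n hn
      set a := (pulls k i b n ω).card with ha_def
      split_ifs with hxa
      swap
      · exact le_rfl
      obtain ⟨j, rfl⟩ : ∃ j, n = b + j := ⟨n - b, by omega⟩
      have hjτ : j ∈ Finset.range τ := Finset.mem_range.2 (by omega)
      have hlb : l j ≤ b := max_le hb (by omega)
      have hw := windowPulls_eq τ k i (b + j) ω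
      have hcards := card_pulls_append k i hlb hn1 ω
      have hsums := sum_pulls_append k i hlb hn1 ω (fun t => X i t ω - meanReward P X i t)
      have ha0 : (0 : ℝ) < a := hx0.trans_le hxa
      have hNpos : 0 < (windowPulls τ k i (b + j) ω).card := by
        rw [hw]
        have : (0 : ℝ) < (pulls k i (l j) (b + j) ω).card := by
          rw [hcards]
          positivity
        exact_mod_cast this
      have hnoise := noise_ge_of_le_swIndex (P := P) hδ hδ0.le hD hω (hmean (b + j) hBn hn1)
        hNpos hqn
      rw [hw] at hnoise
      change 31 / 48 * D * ((pulls k i (l j) (b + j) ω).card : ℝ) - 3 * δ / (8 * D)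
        ≤ ∑ t ∈ pulls k i (l j) (b + j) ω, (X i t ω - meanReward P X i t) at hnoise
      rw [hcards, hsums, ← ha_def] at hnoise
      -- If the noise inside the block is below `γa = Da/48`, the earlier part carries the rest:
      -- `31/48 - 1/48 = 5/8` is the slope in `β`.
      by_cases hWB : γ * a ≤ ∑ t ∈ pulls k i b (b + j) ω, (X i t ω - meanReward P X i t)
      · have hSB : ∀ t, t ∈ pulls k i b (b + j) ω ↔ (b ≤ t ∧ t < b + τ) ∧ ω ∈ JB a t := by
          intro t
          rw [mem_pulls]
          constructor
          · rintro ⟨⟨h1, h2⟩, h3⟩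
            exact ⟨⟨h1, by omega⟩, h3, card_pulls_lt h1 h2 h3⟩
          · rintro ⟨⟨h1, h2⟩, h3, h4⟩
            refine ⟨⟨h1, ?_⟩, h3⟩
            by_contra hcon
            exact absurd h4 (not_lt.2 (card_pulls_mono k i b (not_lt.1 hcon) ω))
        have hone := one_le_hoeffding_selProd (P := P) (X := X) (i := i) hSB (α := γ / 2)
          (β := γ / 2 * a) (by positivity) (by
            rw [← ha_def]
            linarith)
        refine hone.trans (le_add_of_nonneg_left ?_)
        exact Finset.sum_nonneg fun j _ => mul_nonneg (Real.exp_pos _).le (hZA0 j ω)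
      · have hSA : ∀ t, t ∈ pulls k i (l j) b ω ↔ (l j ≤ t ∧ t < b) ∧ ω ∈ JA t :=
          fun t => mem_pulls
        have hone := one_le_hoeffding_selProd (P := P) (X := X) (i := i) hSA (α := α)
          (β := β a) (by positivity) (by
            simp only [hα, hβ]
            rw [not_le, hγ] at hWB
            linarith)
        refine hone.trans (le_trans (Finset.single_le_sum
          (f := fun j => Real.exp (-(8 * α * β a)) * ZA j ω)
          (fun j _ => mul_nonneg (Real.exp_pos _).le (hZA0 j ω)) hjτ)
          (le_add_of_nonneg_right ?_))
        exact mul_nonneg (Real.exp_pos _).le (hZB0 a ω)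
    · split_ifs
      · exact hA0 a ω
      · exact zero_le_one

end Block

/-! ### Small gaps and close edges -/

open Classical in
/-- Under unimodality, an arm of gap less than `Δ` is optimal or has an adjacent close arm. -/
theorem UnimodalTies.gap_le {K : ℕ} {G : SimpleGraph (Fin K)} {v : Fin K → ℝ}
    (h : UnimodalTies G v) {Δ : ℝ} (hΔ : 0 ≤ Δ) {i : Fin K} (hi : (⨆ j, v j) - v i < Δ) :
    (⨆ j, v j) - v i
      ≤ (Finset.card {e : Fin K × Fin K | e.1 < e.2 ∧ G.Adj e.1 e.2 ∧ |v e.1 - v e.2| < Δ} : ℝ)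
        * Δ := by
  have : Nonempty (Fin K) := ⟨i⟩
  have hle : ∀ j, v j ≤ ⨆ j, v j := fun j => le_ciSup (Set.finite_range v).bddAbove j
  obtain ⟨j, hj, hp⟩ := h i
  rcases Relation.ReflTransGen.cases_head hp with rfl | ⟨x, ⟨hadj, hlt⟩, -⟩
  · have : ⨆ j, v j ≤ v i := ciSup_le hj
    have : (⨆ j, v j) - v i ≤ 0 := by linarith
    exact this.trans (by positivity)
  · have habs : |v i - v x| < Δ := by
      rw [abs_lt]
      constructor <;> linarith [hle x]
    have hone : 1 ≤ Finset.card
        {e : Fin K × Fin K | e.1 < e.2 ∧ G.Adj e.1 e.2 ∧ |v e.1 - v e.2| < Δ} := by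
      rw [Nat.one_le_iff_ne_zero, Finset.card_ne_zero]
      rcases lt_or_gt_of_ne hadj.ne with hix | hix
      · exact ⟨(i, x), by simpa using ⟨hix, hadj, habs⟩⟩
      · exact ⟨(x, i), by simpa using ⟨hix, hadj.symm, by rwa [abs_sub_comm]⟩⟩
    have : (1 : ℝ) ≤ Finset.card
        {e : Fin K × Fin K | e.1 < e.2 ∧ G.Adj e.1 e.2 ∧ |v e.1 - v e.2| < Δ} := by
      exact_mod_cast hone
    nlinarith

/-! ### Assembling the regret bound -/

section Regret

variable {K : ℕ} {Ω : Type*} [MeasurableSpace Ω] {P : Measure Ω} [IsProbabilityMeasure P]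
  {X : Fin K → ℕ → Ω → ℝ}

theorem IsRewardProcess.integrable_gap (h : IsRewardProcess P X) {c : ℝ} {τ : ℕ}
    {k : ℕ → Ω → Fin K} (hk : IsSWKLUCB c τ X k) {n : ℕ} (hn : 1 ≤ n) :
    Integrable (fun ω => meanReward P X (k n ω) n) P := by
  refine Integrable.of_mem_Icc 0 1 ?_ (.of_forall fun ω => h.meanReward_mem _ hn)
  have hkm : Measurable (k n) := (hk.measurable_arm n hn).mono (h.past_le _) le_rfl
  exact ((measurable_of_finite fun i : Fin K => meanReward P X i n).comp hkm).aemeasurable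

theorem IsRewardProcess.regret_eq (h : IsRewardProcess P X) {c : ℝ} {τ : ℕ}
    {k : ℕ → Ω → Fin K} (hk : IsSWKLUCB c τ X k) (T : ℕ) :
    regret P X k T
      = ∫ ω, ∑ n ∈ Finset.Icc 1 T, (bestMean P X n - meanReward P X (k n ω) n) ∂P := by
  have hi : ∀ n ∈ Finset.Icc 1 T,
      Integrable (fun ω => bestMean P X n - meanReward P X (k n ω) n) P := fun n hn =>
    (integrable_const _).sub (h.integrable_gap hk (Finset.mem_Icc.1 hn).1)
  rw [integral_finsetSum _ hi]
  refine Finset.sum_congr rfl fun n hn => ?_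
  rw [integral_sub (integrable_const _) (h.integrable_gap hk (Finset.mem_Icc.1 hn).1)]
  simp

/-- A pointwise bound on the sum of the gaps, by a constant and an integrable variable, bounds the
regret. -/
theorem IsRewardProcess.regret_le (h : IsRewardProcess P X) {c : ℝ} {τ : ℕ}
    {k : ℕ → Ω → Fin K} (hk : IsSWKLUCB c τ X k) {T : ℕ} {H : ℝ} {Y : Ω → ℝ}
    (hY : Integrable Y P)
    (hle : ∀ᵐ ω ∂P, ∑ n ∈ Finset.Icc 1 T, (bestMean P X n - meanReward P X (k n ω) n)
      ≤ H + Y ω) :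
    regret P X k T ≤ H + ∫ ω, Y ω ∂P := by
  rw [h.regret_eq hk]
  have hi : Integrable
      (fun ω => ∑ n ∈ Finset.Icc 1 T, (bestMean P X n - meanReward P X (k n ω) n)) P :=
    integrable_finsetSum _ fun n hn =>
      (integrable_const _).sub (h.integrable_gap hk (Finset.mem_Icc.1 hn).1)
  calc _ ≤ ∫ ω, (H + Y ω) ∂P := integral_mono_ae hi ((integrable_const _).add hY) hle
    _ = _ := by
      rw [integral_add (integrable_const _) hY]
      simp

theorem IsRewardProcess.bestMean_mem (h : IsRewardProcess P X) (hK : 0 < K) {n : ℕ} (hn : 1 ≤ n) :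
    bestMean P X n ≤ 1 ∧ (∀ i, meanReward P X i n ≤ bestMean P X n) ∧
      ∃ i, meanReward P X i n = bestMean P X n := by
  have : Nonempty (Fin K) := ⟨⟨0, hK⟩⟩
  refine ⟨ciSup_le fun i => (h.meanReward_mem i hn).2,
    fun i => le_ciSup (Set.finite_range fun i => meanReward P X i n).bddAbove i, ?_⟩
  exact exists_eq_ciSup_of_finite

/-- Regret bound for `τ ≥ 3` and `2τσ < Δ ≤ 1 + 2τσ`, with explicit constants. -/
theorem IsRewardProcess.regret_le_of_three_le (h : IsRewardProcess P X) (hK : 0 < K)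
    {G : SimpleGraph (Fin K)}
    (hG : ∀ n, 1 ≤ n → UnimodalTies G (fun i => meanReward P X i n)) {c σ Δ D δ : ℝ} {τ : ℕ}
    (hδ : δ = Real.log τ + c * Real.log (Real.log τ)) (hδ0 : 0 < δ) (hτ : 0 < τ)
    (hτδ : τ * Real.exp (-δ) ≤ 1) (hσ : 0 ≤ σ)
    (hlip : ∀ i n m, 1 ≤ n → 1 ≤ m →
      |meanReward P X i n - meanReward P X i m| ≤ σ * |(n : ℝ) - (m : ℝ)|)
    (hbest : ∀ n, 1 ≤ n → bestMean P X n < 1)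
    (hΔ : Δ = 2 * τ * σ + D) (hD : 0 < D) (hD1 : D ≤ 1)
    {k : ℕ → Ω → Fin K} (hk : IsSWKLUCB c τ X k) (T : ℕ) :
    regret P X k T ≤ closeCount G (meanReward P X) Δ T * Δ
      + (T * (1153 / (τ * D ^ 2))
        + K * (((T - 1) / τ + 1 : ℕ) * (15 * δ / (16 * D ^ 2) + 1156 / D ^ 2))) := by
  classical
  have hτ' : (0 : ℝ) < τ := by exact_mod_cast hτ
  have hΔ0 : 0 ≤ Δ := by
    rw [hΔ]
    positivity
  have hdrift : ∀ i n t, 1 ≤ t → t < n → n ≤ t + τ →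
      |meanReward P X i n - meanReward P X i t| ≤ σ * τ := by
    intro i n t h1 h2 h3
    refine (hlip i n t (by omega) h1).trans (mul_le_mul_of_nonneg_left ?_ hσ)
    have h4 : (t : ℝ) < n := by exact_mod_cast h2
    have h5 : (n : ℝ) ≤ t + τ := by exact_mod_cast h3
    rw [abs_of_pos (by linarith)]
    linarith
  have hopt : ∀ n, ∃ i : Fin K, 1 ≤ n → meanReward P X i n = bestMean P X n := by
    intro n
    by_cases hn : 1 ≤ n
    · obtain ⟨-, -, i, hi⟩ := h.bestMean_mem hK hn
      exact ⟨i, fun _ => hi⟩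
    · exact ⟨⟨0, hK⟩, fun h => absurd h hn⟩
  choose s hs using hopt
  set q : ℕ → ℝ := fun n => bestMean P X n - σ * τ - D / 48 with hq
  have hστ : 0 ≤ σ * τ := by positivity
  have hY1 : ∀ n, ∃ Y : Ω → ℝ, 1 ≤ n → Integrable Y P ∧ (∀ ω, 0 ≤ Y ω) ∧
      ∫ ω, Y ω ∂P ≤ 1153 / (τ * D ^ 2) ∧
      ∀ᵐ ω ∂P, swIndex c τ X k (s n) n ω < q n → 1 ≤ Y ω := by
    intro n
    by_cases hn : 1 ≤ n
    · obtain ⟨Y, h1, h2, h3, h4⟩ := exists_bound_swIndex_lt h hk (s n) (n := n) (q := q n)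
        (m := bestMean P X n - σ * τ) hδ hδ0.le (by simp only [hq]; linarith)
        (by linarith [hbest n hn])
        (fun t ht1 ht2 ht3 => by
          have := (abs_le.1 (hdrift (s n) n t ht1 ht2 ht3)).2
          rw [hs n hn] at this
          linarith)
      refine ⟨Y, fun _ => ⟨h1, h2, h3.trans ?_, h4⟩⟩
      have e1 : bestMean P X n - σ * τ - q n = D / 48 := by
        simp only [hq]
        ring
      have e2 : 1 + 1 / (2 * (D / 48) ^ 2) ≤ 1153 / D ^ 2 := by
        have e3 : 1 / (2 * (D / 48) ^ 2) = 1152 * (1 / D ^ 2) := by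
          field_simp
          norm_num
        have e4 : 1 ≤ 1 / D ^ 2 := by
          rw [le_div_iff₀ (by positivity)]
          nlinarith
        have e5 : 1153 / D ^ 2 = 1153 * (1 / D ^ 2) := by ring
        rw [e3, e5]
        linarith
      have e6 : Real.exp (-δ) ≤ 1 / τ := by
        rw [le_div_iff₀ hτ']
        linarith
      rw [e1]
      calc Real.exp (-δ) * (1 + 1 / (2 * (D / 48) ^ 2)) ≤ 1 / τ * (1153 / D ^ 2) := by
            gcongr
        _ = 1153 / (τ * D ^ 2) := by
            field_simp
    · exact ⟨fun _ => 0, fun h => absurd h hn⟩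
  choose Y1 hY1 using hY1
  -- Block `u` starts at `uτ + 1` since rounds start at `1`. A gap of at least `Δ = 2τσ + D`, less
  -- one drift `στ`, leaves the window means `47D/48` below `q n`.
  have hY2 := fun (i : Fin K) (u : ℕ) => exists_bound_block h hk i (b := u * τ + 1) (by omega)
    hδ hδ0 hτδ hD hD1 (fun n => Δ ≤ bestMean P X n - meanReward P X i n) q
    (fun n hB hn t ht1 ht2 ht3 => by
      have := (abs_le.1 (hdrift i n t ht1 ht2 ht3)).1
      simp only [hq]
      rw [hΔ] at hB
      linarith)
  choose Y2 hY2i hY2b hY2 using hY2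
  set nb := (T - 1) / τ + 1 with hnb
  have hI1 : Integrable (fun ω => ∑ n ∈ Finset.Icc 1 T, Y1 n ω) P :=
    integrable_finsetSum _ fun n hn => (hY1 n (Finset.mem_Icc.1 hn).1).1
  have hI2 : ∀ i, Integrable (fun ω => ∑ u ∈ Finset.range nb, Y2 i u ω) P := fun i =>
    integrable_finsetSum _ fun u _ => hY2i i u
  have hI3 : Integrable (fun ω => ∑ i, ∑ u ∈ Finset.range nb, Y2 i u ω) P :=
    integrable_finsetSum _ fun i _ => hI2 i
  refine (h.regret_le hk (hI1.add hI3) (H := closeCount G (meanReward P X) Δ T * Δ) ?_).trans ?_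
  · have hae1 : ∀ᵐ ω ∂P, ∀ n, 1 ≤ n → swIndex c τ X k (s n) n ω < q n → 1 ≤ Y1 n ω := by
      rw [ae_all_iff]
      intro n
      rw [Filter.eventually_imp_distrib_left]
      exact fun hn => (hY1 n hn).2.2.2
    have hae2 := ae_all_iff.2 fun i => ae_all_iff.2 fun u => hY2 i u
    filter_upwards [hae1, hae2] with ω hω1 hω2
    set F : Fin K → Finset ℕ := fun i => (Finset.Icc 1 T).filter fun n =>
      Δ ≤ bestMean P X n - meanReward P X i n ∧ k n ω = i ∧ q n ≤ swIndex c τ X k i n ω with hF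
    have hFle : ∀ i, ((F i).card : ℝ) ≤ ∑ u ∈ Finset.range nb, Y2 i u ω := by
      intro i
      set Fb : ℕ → Finset ℕ := fun u => (F i).filter fun n => (n - 1) / τ = u with hFb
      have hcard : (F i).card = ∑ u ∈ Finset.range nb, (Fb u).card := by
        refine Finset.card_eq_sum_card_fiberwise fun n hn => ?_
        have hn' : n ∈ F i := hn
        simp only [hF, Finset.mem_filter, Finset.mem_Icc] at hn'
        have : (n - 1) / τ ≤ (T - 1) / τ := Nat.div_le_div_right (by omega)
        simp only [Finset.coe_range, Set.mem_Iio]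
        omega
      rw [hcard]
      push_cast
      refine Finset.sum_le_sum fun u _ => hω2 i u _ fun n hn => ?_
      simp only [hFb, hF, Finset.mem_filter, Finset.mem_Icc] at hn
      obtain ⟨⟨⟨h1, h2⟩, h3, h4, h5⟩, h6⟩ := hn
      refine ⟨?_, h3, h4, h5⟩
      have h7 := Nat.div_add_mod (n - 1) τ
      have h8 := Nat.mod_lt (n - 1) hτ
      rw [h6, mul_comm] at h7
      omega
    have hpt : ∀ n ∈ Finset.Icc 1 T, bestMean P X n - meanReward P X (k n ω) n
        ≤ (Finset.card {e : Fin K × Fin K | e.1 < e.2 ∧ G.Adj e.1 e.2 ∧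
            |meanReward P X e.1 n - meanReward P X e.2 n| < Δ} : ℝ) * Δ
          + (Y1 n ω + ∑ i, if n ∈ F i then 1 else 0) := by
      intro n hn
      have hn1 := (Finset.mem_Icc.1 hn).1
      have hS0 : (0 : ℝ) ≤ ∑ i, if n ∈ F i then 1 else 0 :=
        Finset.sum_nonneg fun i _ => by split_ifs <;> norm_num
      have hY0 := (hY1 n hn1).2.1 ω
      by_cases hgap : bestMean P X n - meanReward P X (k n ω) n < Δ
      · have := (hG n hn1).gap_le hΔ0 hgap
        change bestMean P X n - meanReward P X (k n ω) n ≤ _ at this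
        refine this.trans (le_add_of_nonneg_right (by linarith))
      · have h1 : bestMean P X n - meanReward P X (k n ω) n ≤ 1 := by
          linarith [(h.bestMean_mem hK hn1).1, (h.meanReward_mem (k n ω) hn1).1]
        -- If the optimal arm's index is not below `q n`, the maximizing arm's index is at least `q
        -- n` too.
        have h2 : 1 ≤ Y1 n ω + ∑ i, if n ∈ F i then (1 : ℝ) else 0 := by
          by_cases hU : swIndex c τ X k (s n) n ω < q n
          · linarith [hω1 n hn1 hU]
          · have hmem : n ∈ F (k n ω) := by
              exact Finset.mem_filter.2 ⟨hn, not_lt.1 hgap, rfl, (not_lt.1 hU).trans (hk.maximizes n hn1 ω _)⟩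
            have h3 := Finset.single_le_sum (f := fun i => if n ∈ F i then (1 : ℝ) else 0)
              (fun i _ => by split_ifs <;> norm_num) (Finset.mem_univ (k n ω))
            simp only [hmem, if_true] at h3
            linarith
        refine h1.trans (h2.trans (le_add_of_nonneg_left (by positivity)))
    refine (Finset.sum_le_sum hpt).trans ?_
    rw [Finset.sum_add_distrib, Finset.sum_add_distrib, ← Finset.sum_mul]
    refine add_le_add (le_of_eq ?_) ?_
    · unfold closeCount
      push_cast
      congr!
    · change _ ≤ ∑ n ∈ Finset.Icc 1 T, Y1 n ω + ∑ i, ∑ u ∈ Finset.range nb, Y2 i u ω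
      refine add_le_add le_rfl ?_
      rw [Finset.sum_comm]
      refine Finset.sum_le_sum fun i _ => le_trans (le_of_eq ?_) (hFle i)
      rw [Finset.sum_ite_mem, Finset.sum_const, nsmul_eq_mul, mul_one,
        Finset.inter_eq_right.2 (Finset.filter_subset _ _)]
  · refine add_le_add le_rfl ?_
    change ∫ ω, (∑ n ∈ Finset.Icc 1 T, Y1 n ω + ∑ i, ∑ u ∈ Finset.range nb, Y2 i u ω) ∂P ≤ _
    rw [integral_add hI1 hI3, integral_finsetSum _ fun n hn => (hY1 n (Finset.mem_Icc.1 hn).1).1,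
      integral_finsetSum _ fun i _ => hI2 i]
    refine add_le_add ?_ ?_
    · refine (Finset.sum_le_sum fun n hn => (hY1 n (Finset.mem_Icc.1 hn).1).2.2.1).trans ?_
      simp
    · have : ∀ i ∈ Finset.univ, ∫ ω, ∑ u ∈ Finset.range nb, Y2 i u ω ∂P
          ≤ nb * (15 * δ / (16 * D ^ 2) + 1156 / D ^ 2) := by
        intro i _
        rw [integral_finsetSum _ fun u _ => hY2i i u]
        refine (Finset.sum_le_sum fun u _ => hY2b i u).trans ?_
        rw [Finset.sum_const, nsmul_eq_mul, Finset.card_range]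
      refine (Finset.sum_le_sum this).trans ?_
      simp

end Regret

/-! ### Numerical estimates and the theorem -/

theorem one_add_rpow_neg_half_ge {x : ℝ} (hx0 : 0 < x) (hx1 : x < 1) :
    15 / 4 ≤ 1 + (x * (1 - x) / 2) ^ (-(1 / 2) : ℝ) := by
  have hg : 0 < x * (1 - x) / 2 := by
    have : 0 < 1 - x := by linarith
    positivity
  rw [Real.rpow_neg hg.le, ← Real.sqrt_eq_rpow]
  have h1 : √(x * (1 - x) / 2) ≤ 4 / 11 := by
    apply Real.sqrt_le_iff.2
    constructor
    · norm_num
    · nlinarith [sq_nonneg (x - 1 / 2)]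
  have h2 : (4 / 11 : ℝ)⁻¹ ≤ (√(x * (1 - x) / 2))⁻¹ := inv_anti₀ (Real.sqrt_pos.2 hg) h1
  norm_num at h2 ⊢
  linarith

theorem neg_one_le_log_log {n : ℕ} (hn : 2 ≤ n) : -1 ≤ Real.log (Real.log n) := by
  have h2 : Real.log 2 ≤ Real.log n := Real.log_le_log (by norm_num) (by exact_mod_cast hn)
  have h3 := Real.log_two_gt_d9
  rw [Real.le_log_iff_exp_le (by linarith), Real.exp_neg]
  have h4 : (2 : ℝ) ≤ Real.exp 1 := by linarith [Real.add_one_le_exp 1]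
  have h5 := inv_anti₀ (by norm_num) h4
  norm_num at h5
  linarith

/-- The left factor is the number of blocks meeting `[1,T]`: if `τ ≤ T` the incomplete block costs
at most another `T`, and otherwise there is a single block. -/
theorem div_add_one_mul_min_le {T τ : ℕ} (hT : 1 ≤ T) :
    (((T - 1) / τ + 1 : ℕ) : ℝ) * min (τ : ℝ) T ≤ 2 * T := by
  rw [← Nat.cast_min]
  have : ((T - 1) / τ + 1) * min τ T ≤ 2 * T := by
    rcases le_total τ T with hle | hle
    · rw [min_eq_left hle, add_mul]
      have := Nat.div_mul_le_self (T - 1) τ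
      omega
    · rw [min_eq_right hle, Nat.div_eq_of_lt (by omega)]
      omega
  exact_mod_cast this

end SlidingBandit

end

theorem mainTheorem7 (c : ℝ) (hc : 0 < c) :
    ∃ C₁ : ℝ, 0 < C₁ ∧
      ∀ (K : ℕ) (_ : 2 ≤ K) (G : SimpleGraph (Fin K))
        (Ω : Type*) (_ : MeasurableSpace Ω) (P : Measure Ω) (_ : IsProbabilityMeasure P)
        (X : Fin K → ℕ → Ω → ℝ) (_ : SlidingBandit.IsRewardProcess P X)
        (_ : ∀ n, 1 ≤ n →
          SlidingBandit.UnimodalTies G (fun i => SlidingBandit.meanReward P X i n))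
        (σ a Δ : ℝ) (τ : ℕ) (_ : 2 ≤ τ)
        (_ : ∀ i n m, 1 ≤ n → 1 ≤ m →
          |SlidingBandit.meanReward P X i n - SlidingBandit.meanReward P X i m|
            ≤ σ * |(n : ℝ) - (m : ℝ)|)
        (_ : 0 < a)
        (_ : ∀ n, 1 ≤ n → SlidingBandit.bestMean P X n ∈ Set.Icc a (1 - a))
        (_ : σ * τ < a) (_ : 2 * τ * σ < Δ)
        (k : ℕ → Ω → Fin K) (_ : SlidingBandit.IsSWKLUCB c τ X k)
        (T : ℕ) (_ : 1 ≤ T),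
        SlidingBandit.regret P X k T / T
          ≤ (SlidingBandit.closeCount G (SlidingBandit.meanReward P X) Δ T : ℝ) * Δ / T
            + K * (1 + ((a - σ * τ) * (1 - a + σ * τ) / 2) ^ (-(1 / 2) : ℝ))
              * (Real.log τ + c * Real.log (Real.log τ) + C₁)
              / (2 * min (τ : ℝ) (T : ℝ) * (Δ - 2 * τ * σ) ^ 2) := by
  classical
  -- The summand `c` offsets `c log log τ ≥ -c` at `τ = 2`; and `(15/4) · 1600 = 6000` leaves `1376K
  -- ≥ 2306` beyond `4624K`, using `K ≥ 2`.
  refine ⟨1600 + c, by linarith, ?_⟩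
  intro K hK2 G Ω _ P _ X h hG σ a Δ τ hτ2 hlip ha hbest hσa hΔ k hk T hT
  have hK : 0 < K := by omega
  have hK' : (2 : ℝ) ≤ K := by exact_mod_cast hK2
  have hτ' : (2 : ℝ) ≤ τ := by exact_mod_cast hτ2
  have hT' : (1 : ℝ) ≤ T := by exact_mod_cast hT
  have hσ : 0 ≤ σ := by
    have h1 := (abs_nonneg _).trans (hlip ⟨0, hK⟩ 2 1 (by norm_num) le_rfl)
    norm_num at h1
    exact h1
  have hστ : 0 ≤ σ * τ := by positivity
  have ha1 : a ≤ 1 - a := (hbest 1 le_rfl).1.trans (hbest 1 le_rfl).2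
  obtain ⟨D, hDdef⟩ : ∃ D, D = Δ - 2 * τ * σ := ⟨_, rfl⟩
  have hD : 0 < D := by linarith
  have hΔ0 : 0 ≤ Δ := by nlinarith
  set g : ℝ := 1 + ((a - σ * τ) * (1 - a + σ * τ) / 2) ^ (-(1 / 2) : ℝ) with hg
  have hg1 : 15 / 4 ≤ g := by
    have := SlidingBandit.one_add_rpow_neg_half_ge (x := a - σ * τ) (by linarith) (by linarith)
    rwa [show 1 - (a - σ * τ) = 1 - a + σ * τ by ring] at this
  set δ : ℝ := Real.log τ + c * Real.log (Real.log τ) with hδ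
  have hlog0 : 0 ≤ Real.log τ := Real.log_nonneg (by linarith)
  have hδC : 1600 ≤ δ + (1600 + c) := by
    nlinarith [SlidingBandit.neg_one_le_log_log hτ2]
  set M : ℝ := min (τ : ℝ) T with hM
  have hM1 : 1 ≤ M := le_min (by linarith) hT'
  rw [← hDdef]
  -- For `τ ≥ 3` one has `log log τ > 0`, hence `τ exp(-δ) ≤ 1`. Otherwise, if `D ≤ 1` then `τ = 2`
  -- and the right side is at least `1`; if `D > 1` then `Δ > 1` and every gap is below `Δ`.
  by_cases hτ3 : 3 ≤ τ ∧ D ≤ 1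
  · obtain ⟨hτ3, hD1⟩ := hτ3
    have hlog1 : 1 < Real.log τ := by
      rw [Real.lt_log_iff_exp_lt (by linarith)]
      have : (3 : ℝ) ≤ τ := by exact_mod_cast hτ3
      linarith [Real.exp_one_lt_d9]
    have hlδ : Real.log τ ≤ δ := by
      have := mul_nonneg hc.le (Real.log_nonneg hlog1.le)
      linarith
    have hδ0 : 0 < δ := by linarith
    have hτδ : τ * Real.exp (-δ) ≤ 1 := by
      calc τ * Real.exp (-δ) ≤ τ * Real.exp (-Real.log τ) :=
            mul_le_mul_of_nonneg_left (Real.exp_le_exp.2 (by linarith)) (by linarith)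
        _ = 1 := by
            rw [Real.exp_neg, Real.exp_log (by linarith)]
            field_simp
    have key := h.regret_le_of_three_le hK hG hδ hδ0 (by omega) hτδ hσ hlip
      (fun n hn => by linarith [(hbest n hn).2]) (Δ := Δ) (by linarith) hD hD1 hk T
    have hnb := SlidingBandit.div_add_one_mul_min_le (τ := τ) hT
    rw [← hM] at hnb
    set nb : ℝ := (((T - 1) / τ + 1 : ℕ) : ℝ)
    have hTpos : (0 : ℝ) < T := by linarith
    have hMpos : 0 < M := by linarith
    have b1 : T * (1153 / (τ * D ^ 2)) ≤ T * (1153 / (M * D ^ 2)) := by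
      have : M ≤ τ := min_le_left _ _
      gcongr
    have b2 : nb * (15 * δ / (16 * D ^ 2) + 1156 / D ^ 2)
        ≤ 2 * T / M * (15 * δ / (16 * D ^ 2) + 1156 / D ^ 2) := by
      refine mul_le_mul_of_nonneg_right ?_ (by positivity)
      rwa [le_div_iff₀ hMpos]
    have b3 := mul_le_mul_of_nonneg_left b2 (show (0 : ℝ) ≤ K by linarith)
    rw [div_le_iff₀ hTpos, add_mul, div_mul_cancel₀ _ hTpos.ne']
    refine key.trans (add_le_add le_rfl ((add_le_add b1 b3).trans ?_))
    have e : T * (1153 / (M * D ^ 2)) + K * (2 * T / M * (15 * δ / (16 * D ^ 2) + 1156 / D ^ 2))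
        = (2306 + K * (15 / 4 * δ + 4624)) / (2 * M * D ^ 2) * T := by
      field_simp
      ring
    rw [e]
    gcongr
    calc 2306 + K * (15 / 4 * δ + 4624) ≤ K * (15 / 4) * (δ + (1600 + c)) := by nlinarith
      _ ≤ K * g * (δ + (1600 + c)) := by gcongr
  · have hterm : 0 ≤ K * g * (δ + (1600 + c)) / (2 * M * D ^ 2) := by
      have : 0 ≤ g := by linarith
      have : 0 ≤ δ + (1600 + c) := by linarith
      positivity
    by_cases hD1 : D ≤ 1
    · have hτeq : τ = 2 := by
        by_contra hne
        exact hτ3 ⟨by omega, hD1⟩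
      have hreg : SlidingBandit.regret P X k T ≤ T := by
        refine (h.regret_le hk (H := T) (integrable_const (0 : ℝ)) (.of_forall fun ω => ?_)).trans
          (by simp)
        calc _ ≤ ∑ n ∈ Finset.Icc 1 T, (1 : ℝ) := Finset.sum_le_sum fun n hn => by
              have hn1 := (Finset.mem_Icc.1 hn).1
              linarith [(h.bestMean_mem hK hn1).1, (h.meanReward_mem (k n ω) hn1).1]
          _ = _ := by simp
      have h1 : SlidingBandit.regret P X k T / T ≤ 1 := div_le_one_of_le₀ hreg (by linarith)
      have h2 : 1 ≤ K * g * (δ + (1600 + c)) / (2 * M * D ^ 2) := by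
        rw [one_le_div (by positivity)]
        have hM2 : M ≤ 2 := by
          have : M ≤ τ := min_le_left _ _
          rw [hτeq] at this
          exact_mod_cast this
        have hD2 : D ^ 2 ≤ 1 := by nlinarith
        calc 2 * M * D ^ 2 ≤ 2 * 2 * 1 := by gcongr
          _ ≤ 2 * (15 / 4) * 1600 := by norm_num
          _ ≤ K * g * (δ + (1600 + c)) := by gcongr
      have h3 : 0 ≤ (SlidingBandit.closeCount G (SlidingBandit.meanReward P X) Δ T : ℝ) * Δ / T := by
        positivity
      linarith
    · have hΔ1 : 1 < Δ := by
        have : 0 ≤ 2 * (τ : ℝ) * σ := by positivity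
        linarith
      have hreg : SlidingBandit.regret P X k T
          ≤ (SlidingBandit.closeCount G (SlidingBandit.meanReward P X) Δ T : ℝ) * Δ := by
        refine (h.regret_le hk (integrable_const (0 : ℝ)) (.of_forall fun ω => ?_)).trans
          (by rw [integral_zero, add_zero])
        rw [add_zero]
        unfold SlidingBandit.closeCount
        push_cast
        rw [Finset.sum_mul]
        refine Finset.sum_le_sum fun n hn => ?_
        have hn1 := (Finset.mem_Icc.1 hn).1
        have hgap : (⨆ j, SlidingBandit.meanReward P X j n)
            - SlidingBandit.meanReward P X (k n ω) n < Δ := by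
          have e1 := (h.bestMean_mem hK hn1).1
          unfold SlidingBandit.bestMean at e1
          linarith [(h.meanReward_mem (k n ω) hn1).1]
        refine ((hG n hn1).gap_le hΔ0 hgap).trans (le_of_eq ?_)
        congr!
      have : SlidingBandit.regret P X k T / T
          ≤ (SlidingBandit.closeCount G (SlidingBandit.meanReward P X) Δ T : ℝ) * Δ / T := by
        gcongr
      linarith
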